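/- For a finite Borel measure $\mu$ on $\mathbb R^n$ write $\widehat\mu(\xi)=\int e^{-2\pi i x\cdot\xi}\,d\mu(x)$. Given $C,R\in\mathbb R$, $\delta>0$ and $\varepsilon_0>0$, say that a set $E\subset\mathbb R^n$ satisfies $H(C,\delta,R,\varepsilon_0)$ if $|E|=0$ (Lebesgue measure), any two points of $E$ are at distance at most $R$, and there is a finite positive Borel measure $\mu$ on $\mathbb R^n$ whose closed support is contained in $E$, with total mass $\mu(\mathbb R^n)\ge\delta$, such that (a) for some $\alpha$ with $n-\varepsilon_0<\alpha<n$, $\displaystyle\sup_{x\in E,\ 0<r<1}\frac{\mu(B(x;r))}{r^\alpha}\le C$, and (b) for some $\beta$ with $\frac{2n}{3}<\beta<n$, $\displaystyle\sup_{\xi\in\mathbb R^n}|\widehat\mu(\xi)|\,(1+|\xi|)^{\beta/2}\le C$. (i) Let $a,b,c$ be three distinct collinear points in $\mathbb R^n$. Then for all $C$, $R$ and all $\delta>0$ there is $\varepsilon_0>0$, depending only on $n,a,b,c,C,\delta,R$, such that every $E\subset\mathbb R^n$ satisfying $H(C,\delta,R,\varepsilon_0)$ contains three distinct points $x,y,z$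 such that the triple $(x,y,z)$ is similar to $(a,b,c)$, that is, for some $\lambda>0$ one has $|x-y|=\lambda|a-b|$, $|y-z|=\lambda|b-c|$, $|x-z|=\lambda|a-c|$. (ii) In particular, for all $C$, $R$ and all $\delta>0$ there is $\varepsilon_0>0$, depending only on $n,C,\delta,R$, such that every $E\subset\mathbb R^n$ satisfying $H(C,\delta,R,\varepsilon_0)$ contains a non-trivial three-term arithmetic progression $\{x,x+y,x+2y\}$, $y\ne0$. -/

import Mathlib

open MeasureTheory

noncomputable section

/-- The Fourier transform `ξ ↦ ∫ e^{-2π i x·ξ} dμ(x)` of a measure on `ℝⁿ`. -/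
def measureFourier {n : ℕ} (μ : Measure (EuclideanSpace ℝ (Fin n)))
    (ξ : EuclideanSpace ℝ (Fin n)) : ℂ :=
  ∫ x, Complex.exp (-(2 * Real.pi * Complex.I * ((inner ℝ x ξ : ℝ) : ℂ))) ∂μ

/-- Ball condition of exponent `α` with constant `C`, at the points of `E`:
`sup_{x ∈ E, 0 < r < 1} μ(B(x; r)) / r^α ≤ C`. -/
def BallCondition {n : ℕ} (E : Set (EuclideanSpace ℝ (Fin n)))
    (μ : Measure (EuclideanSpace ℝ (Fin n))) (α C : ℝ) : Prop :=
  ∀ x ∈ E, ∀ r : ℝ, 0 < r → r < 1 → μ.real (Metric.ball x r) / r ^ α ≤ C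

/-- Fourier decay of exponent `β / 2` with constant `C`:
`sup_ξ |μ̂(ξ)| (1 + |ξ|)^{β/2} ≤ C`. -/
def FourierDecay {n : ℕ} (μ : Measure (EuclideanSpace ℝ (Fin n))) (β C : ℝ) : Prop :=
  ∀ ξ : EuclideanSpace ℝ (Fin n), ‖measureFourier μ ξ‖ * (1 + ‖ξ‖) ^ (β / 2) ≤ C

/-- The hypotheses on `E ⊆ ℝⁿ`, with constant `C`, threshold `ε₀`, and normalization
constants `δ` (lower bound for the mass) and `R` (upper bound for the diameter of `E`).
`E` is a Lebesgue null set of diameter at most `R` supporting a finite positive Borel measure `μ`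
(automatically Radon; its closed support is contained in `E`) of mass at least `δ`, which obeys the
ball condition for some `α ∈ (n - ε₀, n)` and Fourier decay for some `β ∈ (2n/3, n)`.
The range of `β` is `2(nk - m)/k < β < n` for three-point configurations `x + B_j y` with
`x, y ∈ ℝⁿ`, that is `k = 3` and `m = 2n`. -/
def SatisfiesHypotheses (n : ℕ) (C δ R ε₀ : ℝ) (E : Set (EuclideanSpace ℝ (Fin n))) : Prop :=
  volume E = 0 ∧
  (∀ x ∈ E, ∀ y ∈ E, dist x y ≤ R) ∧
  ∃ μ : Measure (EuclideanSpace ℝ (Fin n)),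
    IsFiniteMeasure μ ∧ μ.support ⊆ E ∧ δ ≤ μ.real Set.univ ∧
    (∃ α : ℝ, (n : ℝ) - ε₀ < α ∧ α < n ∧ BallCondition E μ α C) ∧
    (∃ β : ℝ, 2 * (n : ℝ) / 3 < β ∧ β < n ∧ FourierDecay μ β C)

end

/-! With `c = a + t • (b - a)`, collinearity and distinctness give `t ≠ 0, 1`, and it suffices to
find `x`, `x + y`, `x + t • y` in the support of `μ` with `y ≠ 0`. The method is transference: `μ`
is compared with its mollification at one fixed scale `r`.

The dense model is a Varnavides-type theorem (`exists_lintegral_pattern_ge`): a function `0 ≤ f ≤ M`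
of mass at least `δ`, supported in a ball, has pattern integral at least `c > 0` over an annulus of
`y`. It follows from the corners theorem, since `(i, j) ↦ x + (i + j t) d` sends corners to
patterns.

On the Fourier side, the form with a smooth cutoff in `y` is bounded by the product of the `L³`
norms of the transforms (`enorm_integral_pattern_le`). The ball condition bounds the `L²` norm of
`μ̂` on balls up to a small power of the radius, and decay supplies the third factor, so `∫ |μ̂|³ (1
+ |ξ|)^{1/12} ≤ Q` with `Q` depending only on the space and `C` (`exists_lintegral_cube_weight_le`).
Hence passing from scale `r` to any smaller scale changes the form by an amount that tends to zero
with `r`.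

The order of the constants avoids circularity. First `M` is fixed with a spare factor `2`, then `c`,
then `r` making the change smaller than `c`, and last `ε₀`, so small that `r ^ (-(n - α)) ≤ 2`. The
mollification at scale `r` is then bounded by `M`, so its form is at least `c`, and the form is
nonzero at every smaller scale. This gives patterns arbitrarily close to the support with `‖y‖`
bounded below; compactness finishes. -/

noncomputable section

/-! ### Patterns in dense sets and bounded functions, from the corners theorem. -/

section Patterns

open Metric
open scoped ENNReal Finset

variable {V : Type*} [NormedAddCommGroup V] [InnerProductSpace ℝ V] [FiniteDimensional ℝ V]
  [MeasurableSpace V] [BorelSpace V]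

/-- The measure of the set of base points `x` such that `x`, `x + y`, `x + t • y` all lie
in `A`. -/
def patternCount (A : Set V) (t : ℝ) (y : V) : ℝ≥0∞ :=
  ∫⁻ x, A.indicator 1 x * A.indicator 1 (x + y) * A.indicator 1 (x + t • y)

theorem measurable_patternCount {A : Set V} (hA : MeasurableSet A) (t : ℝ) :
    Measurable (patternCount A t) := by
  have hi : Measurable (A.indicator (1 : V → ℝ≥0∞)) := measurable_one.indicator hA
  unfold patternCount
  refine Measurable.lintegral_prod_right
    (f := fun y x => A.indicator 1 x * A.indicator 1 (x + y) * A.indicator 1 (x + t • y)) ?_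
  exact ((hi.comp measurable_snd).mul (hi.comp (measurable_snd.add measurable_fst))).mul
    (hi.comp (measurable_snd.add (measurable_fst.const_smul t)))

theorem lintegral_comp_smul_le {r : ℝ} (hr : 1 ≤ |r|) {f : V → ℝ≥0∞} (hf : Measurable f) :
    ∫⁻ x, f (r • x) ≤ ∫⁻ x, f x := by
  have hr0 : r ≠ 0 := by rintro rfl; norm_num at hr
  rw [← lintegral_map hf (measurable_const_smul r), Measure.map_addHaar_smul _ hr0,
    lintegral_smul_measure, smul_eq_mul]
  refine mul_le_of_le_one_left' (ENNReal.ofReal_le_one.2 ?_)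
  rw [abs_inv, abs_pow]
  exact inv_le_one_of_one_le₀ (one_le_pow₀ hr)

/-- The corners theorem with the corner unpacked into its vertices `(i, j)`, `(k, j)`, `(i, l)`. The
common leg `k - i` is nonzero but may be negative, hence the equation in `ℝ`. -/
theorem exists_corner_of_lt_card {ε : ℝ} (hε : 0 < ε) {L : ℕ}
    (hL : cornersTheoremBound (ε / 9) ≤ L) {P : ℕ × ℕ → Prop} [DecidablePred P]
    (h : ε * L ^ 2 < #{p ∈ Finset.range L ×ˢ Finset.range L | P p}) :
    ∃ i ∈ Finset.range L, ∃ j ∈ Finset.range L, ∃ k ∈ Finset.range L, k ≠ i ∧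
      ∃ l : ℕ, (l : ℝ) - j = k - i ∧ P (i, j) ∧ P (k, j) ∧ P (i, l) := by
  have := corners_theorem_nat hε hL _ (Finset.filter_subset _ _) h.le
  unfold IsCornerFree at this
  push Not at this
  obtain ⟨i, j, k, l, hc, hne⟩ := this
  have h1 := hc.fst_fst_mem
  have h2 := hc.fst_snd_mem
  have h3 := hc.snd_fst_mem
  simp only [Finset.coe_filter, Set.mem_ofPred_eq, Finset.mem_product] at h1 h2 h3
  refine ⟨i, h1.1.1, j, h1.1.2, k, h3.1.1, hne.symm, l, ?_, h1.2, h3.2, h2.2⟩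
  have := hc.add_eq_add
  have : (i : ℝ) + l = k + j := by exact_mod_cast this
  linarith

/-- Place the grid `x + (i + j t) d` at every base point `x`. A corner with leg `k - i` becomes a
pattern with difference `(k - i) d`. On average over `x` the grid meets `A` often, and each grid
meeting `A` in more than `ε L²` points contains a pattern. -/
theorem sum_patternCount_ge {t R a : ℝ} {L : ℕ} (hR : 0 < R) (ha : 0 < a) (hL0 : 0 < L)
    (hL : cornersTheoremBound (a / (2 * volume.real (closedBall (0 : V) (R + 1))) / 9) ≤ L)
    {A : Set V} (hA : MeasurableSet A) {x₀ : V} (hAs : A ⊆ closedBall x₀ R)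
    (haA : ENNReal.ofReal a ≤ volume A) {d : V} (hd : ‖d‖ * (L * (1 + |t|)) ≤ 1) :
    ENNReal.ofReal (a / 2) ≤ ∑ i ∈ Finset.range L, ∑ _j ∈ Finset.range L,
      ∑ k ∈ Finset.range L with k ≠ i, patternCount A t (((k : ℝ) - i) • d) := by
  classical
  set v := volume.real (closedBall (0 : V) (R + 1)) with hv
  have hv0 : 0 < v := by
    rw [hv, measureReal_def]
    exact ENNReal.toReal_pos (measure_closedBall_pos volume _ (by linarith)).ne'
      measure_closedBall_lt_top.ne
  -- Chosen so that `ε * v = a / 2`: sparse grids account for at most half of the mass.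
  set ε := a / (2 * v) with hε
  have hε0 : 0 < ε := by positivity
  set χ : V → ℝ≥0∞ := A.indicator 1 with hχ
  have hχm : Measurable χ := measurable_one.indicator hA
  have hχ1 : ∀ x, χ x ≤ 1 := fun x => Set.indicator_le_self' (by simp) x
  set B := closedBall x₀ (R + 1) with hB
  have hLr : (0 : ℝ) < L := by exact_mod_cast hL0
  set G : ℕ → ℕ → ℕ → V → ℝ≥0∞ := fun i j k x =>
    χ (x + ((i : ℝ) + j * t) • d) * χ (x + ((i : ℝ) + j * t) • d + ((k : ℝ) - i) • d) *
      χ (x + ((i : ℝ) + j * t) • d + t • ((k : ℝ) - i) • d) with hG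
  have hGm : ∀ i j k, Measurable (G i j k) := fun i j k => by
    simp only [hG]; fun_prop
  have hGint : ∀ i j k, ∫⁻ x, G i j k x = patternCount A t (((k : ℝ) - i) • d) := fun i j k => by
    simp only [hG, patternCount]
    exact lintegral_add_right_eq_self
      (fun x => χ x * χ (x + ((k : ℝ) - i) • d) * χ (x + t • ((k : ℝ) - i) • d)) _
  set T : V → ℝ≥0∞ := fun x => ∑ i ∈ Finset.range L, ∑ j ∈ Finset.range L,
    ∑ k ∈ Finset.range L with k ≠ i, G i j k x with hT
  set N : V → ℝ≥0∞ := fun x => ∑ p ∈ Finset.range L ×ˢ Finset.range L,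
    χ (x + ((p.1 : ℝ) + p.2 * t) • d) with hN
  have hNint : ∫⁻ x, N x = (L : ℝ≥0∞) ^ 2 * volume A := by
    simp only [hN]
    rw [lintegral_finsetSum _ (fun p _ => by fun_prop)]
    have : ∀ p ∈ Finset.range L ×ˢ Finset.range L,
        ∫⁻ x, χ (x + ((p.1 : ℝ) + p.2 * t) • d) = volume A := fun p _ => by
      rw [lintegral_add_right_eq_self χ, hχ, lintegral_indicator_one hA]
    rw [Finset.sum_congr rfl this, Finset.sum_const, Finset.card_product, Finset.card_range,
      nsmul_eq_mul, Nat.cast_mul, sq]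
  -- Either the grid at `x` is dense and `T x ≥ 1`, or it is sparse and `N x ≤ ε L²`. By `hd` grid
  -- points move by at most `1`, so `N x` vanishes off the enlarged ball `B`.
  have hpt : ∀ x, N x ≤ (L : ℝ≥0∞) ^ 2 * (ENNReal.ofReal ε * B.indicator 1 x + T x) := by
    intro x
    have hNc : N x = (#{p ∈ Finset.range L ×ˢ Finset.range L |
        x + ((p.1 : ℝ) + p.2 * t) • d ∈ A} : ℝ≥0∞) := by
      simp only [hN, hχ, Set.indicator_apply, Pi.one_apply, Finset.sum_boole]
    by_cases hc : ε * L ^ 2 < #{p ∈ Finset.range L ×ˢ Finset.range L |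
        x + ((p.1 : ℝ) + p.2 * t) • d ∈ A}
    · obtain ⟨i, hi, j, hj, k, hk, hki, l, hl, h1, h2, h3⟩ := exists_corner_of_lt_card hε0 hL hc
      have hG1 : G i j k x = 1 := by
        have e2 : x + ((i : ℝ) + j * t) • d + ((k : ℝ) - i) • d
            = x + ((k : ℝ) + j * t) • d := by module
        have e3 : x + ((i : ℝ) + j * t) • d + t • ((k : ℝ) - i) • d
            = x + ((i : ℝ) + l * t) • d := by rw [← hl]; module
        simp only [hG, e2, e3, hχ]
        rw [Set.indicator_of_mem h1, Set.indicator_of_mem h2, Set.indicator_of_mem h3]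
        simp
      have hT1 : 1 ≤ T x := by
        rw [← hG1]
        calc G i j k x ≤ ∑ k ∈ Finset.range L with k ≠ i, G i j k x :=
              Finset.single_le_sum (f := fun k => G i j k x) (fun _ _ => zero_le)
                (Finset.mem_filter.2 ⟨hk, hki⟩)
          _ ≤ ∑ j ∈ Finset.range L, ∑ k ∈ Finset.range L with k ≠ i, G i j k x :=
              Finset.single_le_sum (f := fun j => ∑ k ∈ Finset.range L with k ≠ i, G i j k x)
                (fun _ _ => zero_le) hj
          _ ≤ T x :=
              Finset.single_le_sum (f := fun i => ∑ j ∈ Finset.range L,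
                ∑ k ∈ Finset.range L with k ≠ i, G i j k x) (fun _ _ => zero_le) hi
      calc N x ≤ ∑ p ∈ Finset.range L ×ˢ Finset.range L, 1 :=
            Finset.sum_le_sum fun p _ => hχ1 _
        _ = (L : ℝ≥0∞) ^ 2 * 1 := by
            rw [Finset.sum_const, Finset.card_product, Finset.card_range, nsmul_eq_mul,
              Nat.cast_mul, sq]
        _ ≤ _ := by gcongr; exact hT1.trans le_add_self
    · push Not at hc
      by_cases hx : x ∈ B
      · have : N x ≤ ENNReal.ofReal (ε * L ^ 2) := by
          rw [hNc, ← ENNReal.ofReal_natCast]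
          exact ENNReal.ofReal_le_ofReal hc
        refine this.trans ?_
        rw [Set.indicator_of_mem hx, ENNReal.ofReal_mul hε0.le, mul_comm,
          ENNReal.ofReal_pow hLr.le, ENNReal.ofReal_natCast]
        gcongr
        simp
      · have : N x = 0 := by
          refine Finset.sum_eq_zero fun p hp => Set.indicator_of_notMem (fun hmem => hx ?_) _
          have h1 := hAs hmem
          simp only [Finset.mem_product, Finset.mem_range] at hp
          rw [mem_closedBall, dist_eq_norm] at h1
          rw [hB, mem_closedBall, dist_eq_norm]
          have h2 : ‖((p.1 : ℝ) + p.2 * t) • d‖ ≤ 1 := by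
            rw [norm_smul]
            refine le_trans ?_ hd
            rw [mul_comm]
            gcongr
            have e1 : (p.1 : ℝ) ≤ L := by exact_mod_cast hp.1.le
            have e2 : (p.2 : ℝ) ≤ L := by exact_mod_cast hp.2.le
            calc ‖(p.1 : ℝ) + p.2 * t‖ ≤ ‖(p.1 : ℝ)‖ + ‖p.2 * t‖ := norm_add_le _ _
              _ = p.1 + p.2 * |t| := by simp
              _ ≤ L + L * |t| := by gcongr
              _ = L * (1 + |t|) := by ring
          calc ‖x - x₀‖ = ‖(x + ((p.1 : ℝ) + p.2 * t) • d - x₀) - ((p.1 : ℝ) + p.2 * t) • d‖ := by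
                congr 1; abel
            _ ≤ _ := norm_sub_le _ _
            _ ≤ R + 1 := add_le_add h1 h2
        rw [this]; exact zero_le
  have hTm : Measurable T := by
    simp only [hT]
    exact Finset.measurable_sum _ fun i _ => Finset.measurable_sum _ fun j _ =>
      Finset.measurable_sum _ fun k _ => hGm i j k
  have hTint : ∫⁻ x, T x = ∑ i ∈ Finset.range L, ∑ _j ∈ Finset.range L,
      ∑ k ∈ Finset.range L with k ≠ i, patternCount A t (((k : ℝ) - i) • d) := by
    simp only [hT]
    rw [lintegral_finsetSum _ (fun i _ => Finset.measurable_sum _ fun j _ =>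
      Finset.measurable_sum _ fun k _ => hGm i j k)]
    refine Finset.sum_congr rfl fun i _ => ?_
    rw [lintegral_finsetSum _ (fun j _ => Finset.measurable_sum _ fun k _ => hGm i j k)]
    refine Finset.sum_congr rfl fun j _ => ?_
    rw [lintegral_finsetSum _ (fun k _ => hGm i j k)]
    exact Finset.sum_congr rfl fun k _ => hGint i j k
  rw [← hTint]
  have hI := lintegral_mono (μ := volume) hpt
  have hBm : MeasurableSet B := measurableSet_closedBall
  have hBv : volume B = ENNReal.ofReal v := by
    rw [hB, hv, measureReal_def, ENNReal.ofReal_toReal measure_closedBall_lt_top.ne,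
      Measure.addHaar_closedBall_center]
  have hmB : Measurable fun x => ENNReal.ofReal ε * B.indicator 1 x :=
    measurable_const.mul (measurable_one.indicator hBm)
  rw [hNint, lintegral_const_mul _ (by exact hmB.add hTm),
    lintegral_add_right _ hTm, lintegral_const_mul _ (measurable_one.indicator hBm),
    lintegral_indicator_one hBm, hBv, ← ENNReal.ofReal_mul hε0.le] at hI
  have hεv : ε * v = a / 2 := by rw [hε]; field_simp
  rw [hεv, ENNReal.mul_le_mul_iff_right (by positivity) (by simp)] at hI
  have h2 := haA.trans hI
  rw [show a = a / 2 + a / 2 by ring, ENNReal.ofReal_add (by positivity) (by positivity)] at h2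
  simp only [add_halves] at h2
  exact (ENNReal.add_le_add_iff_left ENNReal.ofReal_ne_top).1 h2

/-- The grid estimate is integrated over steps `d` in an annulus. The factor `k - i` is a nonzero
integer of size at most `L`, so `(k - i) d` stays in a larger annulus away from `0`, and the
dilation has Jacobian factor at most `1`. The `L³` triples `(i, j, k)` account for the denominator
of `c`. -/
theorem exists_lintegral_patternCount_ge [Nontrivial V] (t : ℝ) {R a : ℝ} (hR : 0 < R)
    (ha : 0 < a) :
    ∃ κ ρ c : ℝ, 0 < κ ∧ κ < ρ ∧ 0 < c ∧ ∀ (A : Set V) (x₀ : V), MeasurableSet A →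
      A ⊆ closedBall x₀ R → ENNReal.ofReal a ≤ volume A →
        ENNReal.ofReal c ≤ ∫⁻ y in {y : V | κ ≤ ‖y‖ ∧ ‖y‖ ≤ ρ}, patternCount A t y := by
  set L : ℕ := max 2
    (cornersTheoremBound (a / (2 * volume.real (closedBall (0 : V) (R + 1))) / 9)) with hLdef
  have hL2 : 2 ≤ L := le_max_left _ _
  have hL2r : (2 : ℝ) ≤ L := by exact_mod_cast hL2
  have hL : cornersTheoremBound (a / (2 * volume.real (closedBall (0 : V) (R + 1))) / 9) ≤ L :=
    le_max_right _ _
  set ρ₀ : ℝ := 1 / (L * (1 + |t|)) with hρ₀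
  have hρ₀p : 0 < ρ₀ := by positivity
  set S : Set V := {y : V | ρ₀ / 2 ≤ ‖y‖ ∧ ‖y‖ ≤ ρ₀} with hS
  set S' : Set V := {y : V | ρ₀ / 2 ≤ ‖y‖ ∧ ‖y‖ ≤ L * ρ₀} with hS'
  have hSm : MeasurableSet S :=
    (measurableSet_le measurable_const measurable_norm).inter
      (measurableSet_le measurable_norm measurable_const)
  have hSm' : MeasurableSet S' :=
    (measurableSet_le measurable_const measurable_norm).inter
      (measurableSet_le measurable_norm measurable_const)
  have hSpos : 0 < volume S := by
    -- A ball of radius `ρ₀ / 4` about a vector in the middle of the annulus lies in it.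
    obtain ⟨e, he⟩ := exists_norm_eq V (c := 3 / 4 * ρ₀) (by positivity)
    refine lt_of_lt_of_le (measure_ball_pos volume e (by positivity : 0 < ρ₀ / 4))
      (measure_mono fun y hy => ?_)
    rw [mem_ball, dist_eq_norm] at hy
    have h1 := abs_norm_sub_norm_le y e
    rw [he] at h1
    have := abs_le.1 (h1.trans hy.le)
    exact ⟨by linarith [this.1], by linarith [this.2]⟩
  have hSfin : volume S ≠ ⊤ := by
    refine ((measure_mono fun y hy => ?_).trans_lt
      (measure_closedBall_lt_top (x := (0 : V)) (r := ρ₀))).ne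
    simpa using hy.2
  set c : ℝ := a / 2 * (volume S).toReal / (L ^ 3 : ℝ) with hc
  have hc0 : 0 < c := by
    have := ENNReal.toReal_pos hSpos.ne' hSfin
    positivity
  refine ⟨ρ₀ / 2, L * ρ₀, c, by positivity, by nlinarith, hc0, fun A x₀ hA hAs haA => ?_⟩
  have hΦ := measurable_patternCount hA t
  have key : ENNReal.ofReal (a / 2) * volume S ≤
      (L : ℝ≥0∞) ^ 3 * ∫⁻ y in S', patternCount A t y := by
    calc ENNReal.ofReal (a / 2) * volume S = ∫⁻ _ in S, ENNReal.ofReal (a / 2) := by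
          rw [setLIntegral_const]
      _ ≤ ∫⁻ d in S, ∑ i ∈ Finset.range L, ∑ _j ∈ Finset.range L,
            ∑ k ∈ Finset.range L with k ≠ i, patternCount A t (((k : ℝ) - i) • d) := by
          refine setLIntegral_mono' hSm fun d hd => ?_
          refine sum_patternCount_ge hR ha (by omega) hL hA hAs haA ?_
          calc ‖d‖ * (L * (1 + |t|)) ≤ ρ₀ * (L * (1 + |t|)) := by gcongr; exact hd.2
            _ = 1 := by rw [hρ₀]; field_simp
      _ = ∑ i ∈ Finset.range L, ∑ _j ∈ Finset.range L, ∑ k ∈ Finset.range L with k ≠ i,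
            ∫⁻ d in S, patternCount A t (((k : ℝ) - i) • d) := by
          have hm : ∀ i k : ℕ, Measurable fun d => patternCount A t (((k : ℝ) - i) • d) :=
            fun i k => hΦ.comp (measurable_const_smul _)
          rw [lintegral_finsetSum _ (fun i _ => Finset.measurable_sum _ fun j _ =>
            Finset.measurable_sum _ fun k _ => hm i k)]
          refine Finset.sum_congr rfl fun i _ => ?_
          rw [lintegral_finsetSum _ (fun j _ => Finset.measurable_sum _ fun k _ => hm i k)]
          refine Finset.sum_congr rfl fun j _ => ?_
          rw [lintegral_finsetSum _ (fun k _ => hm i k)]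
      _ ≤ ∑ _i ∈ Finset.range L, ∑ _j ∈ Finset.range L, ∑ _k ∈ Finset.range L,
            ∫⁻ y in S', patternCount A t y := by
          refine Finset.sum_le_sum fun i hi => Finset.sum_le_sum fun j _ =>
            (Finset.sum_le_sum fun k hk => ?_).trans
              (Finset.sum_le_sum_of_subset (Finset.filter_subset _ _))
          rw [Finset.mem_filter, Finset.mem_range] at hk
          rw [Finset.mem_range] at hi
          have h1 : (1 : ℝ) ≤ |(k : ℝ) - i| := by
            have : (1 : ℤ) ≤ |(k : ℤ) - i| :=
              Int.one_le_abs (sub_ne_zero.2 (by exact_mod_cast hk.2))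
            exact_mod_cast this
          have h2 : |(k : ℝ) - i| ≤ L := by
            have e1 : (k : ℝ) ≤ L := by exact_mod_cast hk.1.le
            have e2 : (i : ℝ) ≤ L := by exact_mod_cast hi.le
            rw [abs_le]
            constructor <;> linarith [Nat.cast_nonneg (α := ℝ) k, Nat.cast_nonneg (α := ℝ) i]
          rw [← lintegral_indicator hSm, ← lintegral_indicator hSm']
          refine (lintegral_mono fun d => ?_).trans
            (lintegral_comp_smul_le h1 (hΦ.indicator hSm'))
          refine Set.indicator_le (f := fun d => patternCount A t (((k : ℝ) - i) • d))
            (g := fun d => S'.indicator (patternCount A t) (((k : ℝ) - i) • d))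
            (fun d hd => ?_) d
          rw [Set.indicator_of_mem]
          rw [hS', Set.mem_ofPred_eq, norm_smul, Real.norm_eq_abs]
          exact ⟨hd.1.trans (le_mul_of_one_le_left (norm_nonneg _) h1),
            mul_le_mul h2 hd.2 (norm_nonneg _) (by positivity)⟩
      _ = _ := by
          simp only [Finset.sum_const, Finset.card_range, nsmul_eq_mul]
          ring
  have e : ENNReal.ofReal c = ENNReal.ofReal (a / 2) * volume S / (L : ℝ≥0∞) ^ 3 := by
    rw [hc, ENNReal.ofReal_div_of_pos (by positivity), ENNReal.ofReal_mul (by positivity),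
      ENNReal.ofReal_toReal hSfin, ENNReal.ofReal_pow (by positivity), ENNReal.ofReal_natCast]
  rw [e]
  exact ENNReal.div_le_of_le_mul' key

/-- The level set `{f ≥ s}` with `s = δ / (2 v)` has measure at least `δ / (2 M)`, because values
below `s` contribute at most `δ / 2`. On patterns in that set the product is at least `s ^ 3`. -/
theorem exists_lintegral_pattern_ge [Nontrivial V] (t : ℝ) {R δ M : ℝ} (hR : 0 < R)
    (hδ : 0 < δ) (hM : 0 < M) :
    ∃ κ ρ c : ℝ, 0 < κ ∧ κ < ρ ∧ 0 < c ∧ ∀ (f : V → ℝ) (x₀ : V), Measurable f →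
      (∀ x, 0 ≤ f x) → (∀ x, f x ≤ M) → (∀ x ∉ closedBall x₀ R, f x = 0) →
      ENNReal.ofReal δ ≤ ∫⁻ x, ENNReal.ofReal (f x) →
        ENNReal.ofReal c ≤ ∫⁻ y in {y : V | κ ≤ ‖y‖ ∧ ‖y‖ ≤ ρ},
          ∫⁻ x, ENNReal.ofReal (f x * f (x + y) * f (x + t • y)) := by
  obtain ⟨κ, ρ, c, hκ, hκρ, hc, H⟩ := exists_lintegral_patternCount_ge (V := V) t hR
    (a := δ / (2 * M)) (by positivity)
  set v := volume.real (closedBall (0 : V) R) with hv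
  have hv0 : 0 < v := by
    rw [hv, measureReal_def]
    exact ENNReal.toReal_pos (measure_closedBall_pos volume _ hR).ne' measure_closedBall_lt_top.ne
  set s : ℝ := δ / (2 * v) with hs
  have hs0 : 0 < s := by positivity
  refine ⟨κ, ρ, s ^ 3 * c, hκ, hκρ, by positivity, fun f x₀ hf hf0 hfM hfs hfδ => ?_⟩
  set A : Set V := {x | s ≤ f x} with hA
  have hAm : MeasurableSet A := measurableSet_le measurable_const hf
  have hAs : A ⊆ closedBall x₀ R := fun x hx => by
    by_contra hn
    have : s ≤ f x := hx
    rw [hfs x hn] at this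
    linarith
  have hBm : MeasurableSet (closedBall x₀ R) := measurableSet_closedBall
  have hBv : volume (closedBall x₀ R) = ENNReal.ofReal v := by
    rw [hv, measureReal_def, ENNReal.ofReal_toReal measure_closedBall_lt_top.ne,
      Measure.addHaar_closedBall_center]
  have hAv : ENNReal.ofReal (δ / (2 * M)) ≤ volume A := by
    have h1 : ∀ x, ENNReal.ofReal (f x) ≤ ENNReal.ofReal M * A.indicator 1 x +
        ENNReal.ofReal s * (closedBall x₀ R).indicator 1 x := fun x => by
      by_cases hx : x ∈ A
      · rw [Set.indicator_of_mem hx]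
        exact le_add_right (by simpa using ENNReal.ofReal_le_ofReal (hfM x))
      · by_cases hx' : x ∈ closedBall x₀ R
        · rw [Set.indicator_of_mem hx']
          exact le_add_left (by simpa using ENNReal.ofReal_le_ofReal (not_le.1 hx).le)
        · rw [hfs x hx']; simp
    have h2 := hfδ.trans (lintegral_mono h1)
    have hmB : Measurable fun x => ENNReal.ofReal s * (closedBall x₀ R).indicator 1 x :=
      measurable_const.mul (measurable_one.indicator hBm)
    rw [lintegral_add_right _ hmB,
      lintegral_const_mul _ (measurable_one.indicator hAm),
      lintegral_const_mul _ (measurable_one.indicator hBm), lintegral_indicator_one hBm,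
      lintegral_indicator_one hAm, hBv, ← ENNReal.ofReal_mul hs0.le,
      show s * v = δ / 2 by rw [hs]; field_simp] at h2
    nth_rw 1 [show δ = δ / 2 + δ / 2 by ring] at h2
    rw [ENNReal.ofReal_add (by positivity) (by positivity)] at h2
    have h3 := (ENNReal.add_le_add_iff_right ENNReal.ofReal_ne_top).1 h2
    rw [show δ / (2 * M) = δ / 2 / M by field_simp, ENNReal.ofReal_div_of_pos hM]
    exact ENNReal.div_le_of_le_mul' h3
  rw [ENNReal.ofReal_mul (by positivity)]
  refine (mul_le_mul_right (H A x₀ hAm hAs hAv) _).trans ?_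
  rw [← lintegral_const_mul _ (measurable_patternCount hAm t)]
  refine lintegral_mono fun y => ?_
  have hi : Measurable (A.indicator (1 : V → ℝ≥0∞)) := measurable_one.indicator hAm
  rw [patternCount, ← lintegral_const_mul _ (by fun_prop)]
  refine lintegral_mono fun x => ?_
  by_cases h1 : x ∈ A
  · by_cases h2 : x + y ∈ A
    · by_cases h3 : x + t • y ∈ A
      · simp only [Set.indicator_of_mem h1, Set.indicator_of_mem h2, Set.indicator_of_mem h3,
          Pi.one_apply, mul_one]
        refine ENNReal.ofReal_le_ofReal ?_
        have h1' : s ≤ f x := h1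
        have h2' : s ≤ f (x + y) := h2
        have h3' : s ≤ f (x + t • y) := h3
        calc s ^ 3 = s * s * s := by ring
          _ ≤ _ := by gcongr <;> simp [hf0, mul_nonneg]
      · simp [Set.indicator_of_notMem h3]
    · simp [Set.indicator_of_notMem h2]
  · simp [Set.indicator_of_notMem h1]

end Patterns

end

noncomputable section

/-! ### Fourier representation and `L³` bound for the trilinear form. -/

section Trilinear

open Real FourierTransform Module
open scoped ENNReal RealInnerProductSpace

variable {V : Type*} [NormedAddCommGroup V] [InnerProductSpace ℝ V] [FiniteDimensional ℝ V]
  [MeasurableSpace V] [BorelSpace V]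

theorem lintegral_comp_add_smul {r : ℝ} (hr : r ≠ 0) (v : V) {g : V → ℝ≥0∞}
    (hg : Measurable g) :
    ∫⁻ x, g (v + r • x) = ENNReal.ofReal |(r ^ finrank ℝ V)⁻¹| * ∫⁻ x, g x := by
  rw [← lintegral_map (f := fun x => g (v + x)) (by fun_prop) (measurable_const_smul r),
    Measure.map_addHaar_smul _ hr, lintegral_smul_measure, smul_eq_mul,
    lintegral_add_left_eq_self]

theorem lintegral_mul_mul_le_rpow_third {α : Type*} [MeasurableSpace α] {μ : Measure α}
    {a b c : α → ℝ≥0∞} (ha : Measurable a) (hb : Measurable b) (hc : Measurable c) :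
    ∫⁻ x, a x * b x * c x ∂μ ≤ (∫⁻ x, a x ^ 3 ∂μ) ^ (1 / 3 : ℝ) *
      (∫⁻ x, b x ^ 3 ∂μ) ^ (1 / 3 : ℝ) * (∫⁻ x, c x ^ 3 ∂μ) ^ (1 / 3 : ℝ) := by
  have h := ENNReal.lintegral_prod_norm_pow_le (μ := μ) (Finset.univ : Finset (Fin 3))
    (f := ![fun x => a x ^ 3, fun x => b x ^ 3, fun x => c x ^ 3])
    (by
      intro i _
      fin_cases i
      · exact (ha.pow_const 3).aemeasurable
      · exact (hb.pow_const 3).aemeasurable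
      · exact (hc.pow_const 3).aemeasurable)
    (p := fun _ => 1 / 3) (by simp) (fun _ _ => by positivity)
  have e : ∀ y : ℝ≥0∞, (y ^ 3) ^ (1 / 3 : ℝ) = y := fun y => by
    rw [← ENNReal.rpow_natCast, ← ENNReal.rpow_mul]; norm_num
  simp only [Fin.prod_univ_three, Matrix.cons_val_zero, Matrix.cons_val_one,
    Matrix.cons_val_two, e] at h
  refine h.trans_eq' ?_
  exact lintegral_congr fun x => congrArg _ (e (c x))

theorem continuous_fourier_of_integrable {f : V → ℂ} (hf : Integrable f) :
    Continuous (𝓕 f) :=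
  VectorFourier.fourierIntegral_continuous Real.continuous_fourierChar
    (by exact continuous_inner) hf

theorem eq_integral_fourier_mul {f : V → ℂ} (hc : Continuous f) (hf : Integrable f)
    (hf' : Integrable (𝓕 f)) (x : V) : f x = ∫ ξ, 𝓕 f ξ * (𝐞 ⟪ξ, x⟫ : ℂ) := by
  conv_lhs => rw [← hc.fourierInv_fourier_eq hf hf', Real.fourierInv_eq]
  simp only [Circle.smul_def, smul_eq_mul, mul_comm]

theorem fourier_eq_integral_mul (f : V → ℂ) (ξ : V) :
    𝓕 f ξ = ∫ x, f x * (𝐞 (-⟪x, ξ⟫) : ℂ) := by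
  rw [Real.fourier_eq]
  simp only [Circle.smul_def, smul_eq_mul, mul_comm]

/-- In the coordinates `x`, `x + y` the third point is `(1 - t) x + t (x + y)`. Inverting only `f₂`
and `w` leaves an absolutely integrable kernel on four variables; Fubini then turns the two
remaining integrals into the transforms of `f₀` and `f₁`. -/
theorem integral_pattern_eq_integral_fourier (t : ℝ) {f₀ f₁ f₂ w : V → ℂ}
    (h₀ : Integrable f₀) (h₁ : Integrable f₁) (h₂ : Integrable f₂) (hw : Integrable w)
    (h₂c : Continuous f₂) (hwc : Continuous w) (h₂' : Integrable (𝓕 f₂))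
    (hw' : Integrable (𝓕 w)) :
    ∫ p : V × V, f₀ p.1 * f₁ (p.1 + p.2) * f₂ (p.1 + t • p.2) * w p.2 =
      ∫ q : V × V, 𝓕 w q.1 * 𝓕 f₂ q.2 *
        (𝓕 f₀ (q.1 + (t - 1) • q.2) * 𝓕 f₁ (-q.1 + (-t) • q.2)) := by
  have hmp : MeasurePreserving (MeasurableEquiv.shearAddRight V) volume volume :=
    measurePreserving_prod_add (volume : Measure V) (volume : Measure V)
  have e1 : ∫ p : V × V, f₀ p.1 * f₁ (p.1 + p.2) * f₂ (p.1 + t • p.2) * w p.2 =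
      ∫ p : V × V, f₀ p.1 * f₁ p.2 * (f₂ ((1 - t) • p.1 + t • p.2) * w (p.2 - p.1)) := by
    rw [← hmp.integral_comp (MeasurableEquiv.shearAddRight V).measurableEmbedding
      (fun p : V × V => f₀ p.1 * f₁ p.2 * (f₂ ((1 - t) • p.1 + t • p.2) * w (p.2 - p.1)))]
    refine integral_congr_ae (ae_of_all _ fun p => ?_)
    have : (1 - t) • p.1 + t • (p.1 + p.2) = p.1 + t • p.2 := by module
    change _ = f₀ p.1 * f₁ (p.1 + p.2) *
      (f₂ ((1 - t) • p.1 + t • (p.1 + p.2)) * w (p.1 + p.2 - p.1))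
    rw [this, add_sub_cancel_left]
    ring
  set H : V × V → V × V → ℂ := fun p q =>
    (f₀ p.1 * f₁ p.2) * (𝓕 w q.1 * 𝓕 f₂ q.2) *
      (𝐞 (⟪q.1, p.2 - p.1⟫ + ⟪q.2, (1 - t) • p.1 + t • p.2⟫) : ℂ) with hH
  have hHint : Integrable (Function.uncurry H) (volume.prod volume) := by
    have hb := (h₀.mul_prod h₁).mul_prod (hw'.mul_prod h₂')
    refine hb.mul_bdd (c := 1) ?_ (ae_of_all _ fun z => (Circle.norm_coe _).le)
    refine Continuous.aestronglyMeasurable ?_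
    simp only [Real.fourierChar_apply]
    fun_prop
  rw [e1]
  calc _ = ∫ p : V × V, ∫ q : V × V, H p q := by
        refine integral_congr_ae (ae_of_all _ fun p => ?_)
        simp only [hH]
        rw [eq_integral_fourier_mul h₂c h₂ h₂', eq_integral_fourier_mul hwc hw hw', mul_comm
          (∫ ξ, 𝓕 f₂ ξ * _), ← integral_prod_mul, ← integral_const_mul]
        refine integral_congr_ae (ae_of_all _ fun q => ?_)
        simp only [AddChar.map_add_eq_mul, Circle.coe_mul]
        ring
    _ = ∫ q : V × V, ∫ p : V × V, H p q := integral_integral_swap hHint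
    _ = _ := by
        refine integral_congr_ae (ae_of_all _ fun q => ?_)
        simp only [hH]
        rw [fourier_eq_integral_mul f₀, fourier_eq_integral_mul f₁, ← integral_prod_mul,
          ← integral_const_mul]
        refine integral_congr_ae (ae_of_all _ fun p => ?_)
        have e2 : ⟪q.1, p.2 - p.1⟫ + ⟪q.2, (1 - t) • p.1 + t • p.2⟫ =
            -⟪p.1, q.1 + (t - 1) • q.2⟫ + -⟪p.2, -q.1 + (-t) • q.2⟫ := by
          simp only [inner_sub_right, inner_add_right, inner_smul_right, inner_neg_right,
            real_inner_comm q.1, real_inner_comm q.2]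
          ring
        simp only [e2, AddChar.map_add_eq_mul, Circle.coe_mul]
        ring

/-- For each fixed frequency of `w`, Hölder with three exponents `3` applies in the other frequency.
The arguments of `𝓕 f₀` and `𝓕 f₁` are then affine with slopes `t - 1` and `-t`, invertible exactly
when `t ≠ 1` and `t ≠ 0`. -/
theorem enorm_integral_pattern_le {t : ℝ} (ht0 : t ≠ 0) (ht1 : t ≠ 1) {f₀ f₁ f₂ w : V → ℂ}
    (h₀ : Integrable f₀) (h₁ : Integrable f₁) (h₂ : Integrable f₂) (hw : Integrable w)
    (h₂c : Continuous f₂) (hwc : Continuous w) (h₂' : Integrable (𝓕 f₂))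
    (hw' : Integrable (𝓕 w)) :
    ‖∫ p : V × V, f₀ p.1 * f₁ (p.1 + p.2) * f₂ (p.1 + t • p.2) * w p.2‖ₑ ≤
      (∫⁻ ζ, ‖𝓕 w ζ‖ₑ) * ((∫⁻ ξ, ‖𝓕 f₂ ξ‖ₑ ^ 3) ^ (1 / 3 : ℝ) *
        (ENNReal.ofReal |((t - 1) ^ finrank ℝ V)⁻¹| * ∫⁻ ξ, ‖𝓕 f₀ ξ‖ₑ ^ 3) ^ (1 / 3 : ℝ) *
        (ENNReal.ofReal |((-t) ^ finrank ℝ V)⁻¹| * ∫⁻ ξ, ‖𝓕 f₁ ξ‖ₑ ^ 3) ^ (1 / 3 : ℝ)) := by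
  have m₀ := (continuous_fourier_of_integrable h₀).enorm.measurable
  have m₁ := (continuous_fourier_of_integrable h₁).enorm.measurable
  have m₂ := (continuous_fourier_of_integrable h₂).enorm.measurable
  have mw := (continuous_fourier_of_integrable hw).enorm.measurable
  rw [integral_pattern_eq_integral_fourier t h₀ h₁ h₂ hw h₂c hwc h₂' hw']
  refine (enorm_integral_le_lintegral_enorm _).trans ?_
  simp only [enorm_mul]
  rw [Measure.volume_eq_prod, lintegral_prod _ (by
    refine Measurable.aemeasurable ?_
    exact ((mw.comp measurable_fst).mul (m₂.comp measurable_snd)).mul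
      ((m₀.comp (by fun_prop : Measurable fun q : V × V => q.1 + (t - 1) • q.2)).mul
        (m₁.comp (by fun_prop : Measurable fun q : V × V => -q.1 + (-t) • q.2)))),
    ← lintegral_mul_const _ mw]
  refine lintegral_mono fun ζ => ?_
  have n₀ : Measurable fun η : V => ‖𝓕 f₀ (ζ + (t - 1) • η)‖ₑ :=
    m₀.comp (by fun_prop : Measurable fun η : V => ζ + (t - 1) • η)
  have n₁ : Measurable fun η : V => ‖𝓕 f₁ (-ζ + (-t) • η)‖ₑ :=
    m₁.comp (by fun_prop : Measurable fun η : V => -ζ + (-t) • η)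
  simp only [mul_assoc ‖𝓕 w ζ‖ₑ]
  rw [lintegral_const_mul _ (by exact m₂.mul (n₀.mul n₁))]
  gcongr
  simp only [← mul_assoc]
  refine (lintegral_mul_mul_le_rpow_third m₂ n₀ n₁).trans (le_of_eq ?_)
  rw [lintegral_comp_add_smul (sub_ne_zero.2 ht1) ζ (m₀.pow_const 3),
    lintegral_comp_add_smul (neg_ne_zero.2 ht0) (-ζ) (m₁.pow_const 3)]

end Trilinear

end

noncomputable section

/-! ### Mollified measures and their Fourier transforms. -/

section Mollify

set_option linter.unusedSectionVars false

open Real FourierTransform Module Metric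
open scoped ENNReal RealInnerProductSpace

variable {V : Type*} [NormedAddCommGroup V] [InnerProductSpace ℝ V] [FiniteDimensional ℝ V]
  [MeasurableSpace V] [BorelSpace V]

/-- The Fourier transform of a measure on a finite-dimensional inner product space. -/
def measFourier (μ : Measure V) (ξ : V) : ℂ := ∫ x, (𝐞 (-⟪x, ξ⟫) : ℂ) ∂μ

/-- The convolution of a measure with a normalized bump function. -/
def mollify (μ : Measure V) (φ : ContDiffBump (0 : V)) (x : V) : ℝ :=
  ∫ z, φ.normed volume (x - z) ∂μ

theorem norm_measFourier_le (μ : Measure V) [IsFiniteMeasure μ] (ξ : V) :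
    ‖measFourier μ ξ‖ ≤ μ.real Set.univ := by
  refine (norm_integral_le_of_norm_le_const (C := 1)
    (ae_of_all _ fun x => (Circle.norm_coe _).le)).trans (by simp)

theorem continuous_measFourier (μ : Measure V) [IsFiniteMeasure μ] :
    Continuous (measFourier μ) := by
  refine continuous_of_dominated (bound := fun _ => 1) (fun ξ => ?_)
    (fun ξ => ae_of_all _ fun x => (Circle.norm_coe _).le) (integrable_const _)
    (ae_of_all _ fun x => ?_)
  · refine Continuous.aestronglyMeasurable ?_
    simp only [Real.fourierChar_apply]
    fun_prop
  · simp only [Real.fourierChar_apply]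
    fun_prop

theorem measFourier_zero (μ : Measure V) : measFourier μ 0 = μ.real Set.univ := by
  simp [measFourier]

theorem norm_normed_le (φ : ContDiffBump (0 : V)) (x : V) :
    ‖φ.normed volume x‖ ≤ 1 / volume.real (closedBall (0 : V) φ.rIn) := by
  rw [Real.norm_of_nonneg (φ.nonneg_normed x)]
  exact φ.normed_le_div_measure_closedBall_rIn volume x

theorem integrable_normed_sub (μ : Measure V) [IsFiniteMeasure μ] (φ : ContDiffBump (0 : V))
    (x : V) : Integrable (fun z => φ.normed volume (x - z)) μ :=
  (integrable_const (1 / volume.real (closedBall (0 : V) φ.rIn))).mono'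
    ((φ.continuous_normed.comp (continuous_const.sub continuous_id)).aestronglyMeasurable)
    (ae_of_all _ fun _ => norm_normed_le φ _)

theorem continuous_mollify (μ : Measure V) [IsFiniteMeasure μ] (φ : ContDiffBump (0 : V)) :
    Continuous (mollify μ φ) := by
  refine continuous_of_dominated
    (bound := fun _ => 1 / volume.real (closedBall (0 : V) φ.rIn)) (fun x => ?_)
    (fun x => ae_of_all _ fun _ => norm_normed_le φ _) (integrable_const _)
    (ae_of_all _ fun z => φ.continuous_normed.comp (continuous_id.sub continuous_const))
  exact (φ.continuous_normed.comp (continuous_const.sub continuous_id)).aestronglyMeasurable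

theorem mollify_nonneg (μ : Measure V) (φ : ContDiffBump (0 : V)) (x : V) : 0 ≤ mollify μ φ x :=
  integral_nonneg fun _ => φ.nonneg_normed _

theorem normed_sub_eq_zero (φ : ContDiffBump (0 : V)) {x z : V} (h : z ∉ ball x φ.rOut) :
    φ.normed volume (x - z) = 0 := by
  rw [← Function.notMem_support, φ.support_normed_eq]
  simpa [dist_eq_norm, norm_sub_rev] using h

theorem exists_mem_support_of_mollify_ne_zero {μ : Measure V} {φ : ContDiffBump (0 : V)} {x : V}
    (h : mollify μ φ x ≠ 0) : ∃ z ∈ μ.support, dist z x < φ.rOut := by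
  by_contra! hn
  refine h (integral_eq_zero_of_ae ?_)
  filter_upwards [μ.support_mem_ae] with z hz
  exact normed_sub_eq_zero φ (fun hm => (hn z hz).not_gt hm)

/-- Ball bounds are available only at points of the support. If the mollification is nonzero at `x`,
a support point lies within `φ.rOut`, and its ball of doubled radius contains the one about `x`. -/
theorem mollify_le_of_ball {μ : Measure V} [IsFiniteMeasure μ] {φ : ContDiffBump (0 : V)}
    {B : ℝ} (hB : 0 ≤ B) (h : ∀ z ∈ μ.support, μ.real (ball z (2 * φ.rOut)) ≤ B) (x : V) :
    mollify μ φ x ≤ 1 / volume.real (closedBall (0 : V) φ.rIn) * B := by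
  by_cases hx : mollify μ φ x = 0
  · rw [hx]; positivity
  obtain ⟨z, hz, hzx⟩ := exists_mem_support_of_mollify_ne_zero hx
  have h1 : μ.real (ball x φ.rOut) ≤ B := by
    refine (measureReal_mono ?_).trans (h z hz)
    exact ball_subset_ball' (by rw [dist_comm x z]; linarith)
  have h2 : mollify μ φ x ≤ ∫ z in ball x φ.rOut, 1 / volume.real (closedBall (0 : V) φ.rIn) ∂μ := by
    rw [mollify, ← integral_indicator measurableSet_ball]
    refine integral_mono (integrable_normed_sub μ φ x)
      ((integrable_const _).indicator measurableSet_ball) fun y => ?_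
    by_cases hy : y ∈ ball x φ.rOut
    · rw [Set.indicator_of_mem hy]
      exact φ.normed_le_div_measure_closedBall_rIn volume _
    · rw [Set.indicator_of_notMem hy, normed_sub_eq_zero φ hy]
  refine h2.trans ?_
  rw [setIntegral_const, smul_eq_mul, mul_comm]
  gcongr

theorem integrable_prod_normed_sub (μ : Measure V) [IsFiniteMeasure μ]
    (φ : ContDiffBump (0 : V)) :
    Integrable (fun p : V × V => φ.normed volume (p.1 - p.2)) (volume.prod μ) := by
  refine (integrable_prod_iff' ?_).2 ⟨ae_of_all _ fun z => ?_, ?_⟩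
  · exact (φ.continuous_normed.comp (continuous_fst.sub continuous_snd)).aestronglyMeasurable
  · exact φ.integrable_normed.comp_sub_right z
  · have : ∀ z : V, ∫ x, ‖φ.normed volume (x - z)‖ = 1 := fun z => by
      rw [integral_sub_right_eq_self (fun x => ‖φ.normed volume x‖) z, ← φ.integral_normed
        (μ := volume)]
      simp only [Real.norm_of_nonneg (φ.nonneg_normed _)]
    simp only [this]
    exact integrable_const _

theorem integrable_mollify (μ : Measure V) [IsFiniteMeasure μ] (φ : ContDiffBump (0 : V)) :
    Integrable (mollify μ φ) :=
  (integrable_prod_normed_sub μ φ).integral_prod_left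

theorem integral_mollify (μ : Measure V) [IsFiniteMeasure μ] (φ : ContDiffBump (0 : V)) :
    ∫ x, mollify μ φ x = μ.real Set.univ := by
  simp only [mollify]
  rw [integral_integral_swap (integrable_prod_normed_sub μ φ)]
  have : ∀ z : V, ∫ x, φ.normed volume (x - z) = 1 := fun z => by
    rw [integral_sub_right_eq_self (fun x => φ.normed volume x) z, φ.integral_normed]
  simp [this]

/-- The mollification of a measure, as a complex-valued function. -/
def cmollify (μ : Measure V) (φ : ContDiffBump (0 : V)) (x : V) : ℂ := mollify μ φ x

/-- A normalized bump function, as a complex-valued function. -/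
def cbump (φ : ContDiffBump (0 : V)) (x : V) : ℂ := φ.normed volume x

theorem continuous_cmollify (μ : Measure V) [IsFiniteMeasure μ] (φ : ContDiffBump (0 : V)) :
    Continuous (cmollify μ φ) :=
  Complex.continuous_ofReal.comp (continuous_mollify μ φ)

theorem integrable_cmollify (μ : Measure V) [IsFiniteMeasure μ] (φ : ContDiffBump (0 : V)) :
    Integrable (cmollify μ φ) := (integrable_mollify μ φ).ofReal

theorem fourier_cmollify (μ : Measure V) [IsFiniteMeasure μ] (φ : ContDiffBump (0 : V)) (ξ : V) :
    𝓕 (cmollify μ φ) ξ = measFourier μ ξ * 𝓕 (cbump φ) ξ := by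
  rw [fourier_eq_integral_mul]
  have e1 : ∀ x, cmollify μ φ x * (𝐞 (-⟪x, ξ⟫) : ℂ) =
      ∫ z, (φ.normed volume (x - z) : ℂ) * (𝐞 (-⟪x, ξ⟫) : ℂ) ∂μ := fun x => by
    rw [integral_mul_const, cmollify, mollify, integral_complex_ofReal]
  simp only [e1]
  rw [integral_integral_swap]
  · rw [measFourier, ← integral_mul_const]
    refine integral_congr_ae (ae_of_all _ fun z => ?_)
    simp only
    rw [fourier_eq_integral_mul, ← integral_const_mul]
    conv_rhs => rw [← integral_sub_right_eq_self _ z]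
    refine integral_congr_ae (ae_of_all _ fun x => ?_)
    have : -⟪x, ξ⟫ = -⟪z, ξ⟫ + -⟪x - z, ξ⟫ := by rw [inner_sub_left]; ring
    simp only [this, cbump, AddChar.map_add_eq_mul, Circle.coe_mul]
    ring
  · refine (integrable_prod_normed_sub μ φ).ofReal.mul_bdd (c := 1) ?_
      (ae_of_all _ fun z => (Circle.norm_coe _).le)
    refine Continuous.aestronglyMeasurable ?_
    simp only [Real.fourierChar_apply]
    fun_prop

theorem integrable_cbump (φ : ContDiffBump (0 : V)) : Integrable (cbump φ) :=
  φ.integrable_normed.ofReal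

theorem norm_fourier_cbump_le_one (φ : ContDiffBump (0 : V)) (ξ : V) :
    ‖𝓕 (cbump φ) ξ‖ ≤ 1 := by
  refine (VectorFourier.norm_fourierIntegral_le_integral_norm _ _ _ _ _).trans (le_of_eq ?_)
  rw [← φ.integral_normed (μ := volume)]
  simp only [cbump, Complex.norm_real, Real.norm_of_nonneg (φ.nonneg_normed _)]

/-- The bump has integral `1` and lives where `|⟪x, ξ⟫| ≤ φ.rOut * ‖ξ‖`; there `|e^{iθ} - 1| ≤ |θ|`
suffices. -/
theorem norm_one_sub_fourier_cbump_le (φ : ContDiffBump (0 : V)) (ξ : V) :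
    ‖1 - 𝓕 (cbump φ) ξ‖ ≤ 2 * π * φ.rOut * ‖ξ‖ := by
  have e1 : (1 : ℂ) - 𝓕 (cbump φ) ξ = ∫ x, cbump φ x * (1 - (𝐞 (-⟪x, ξ⟫) : ℂ)) := by
    simp only [mul_sub, mul_one]
    rw [integral_sub (integrable_cbump φ), ← fourier_eq_integral_mul]
    · simp only [cbump]
      rw [integral_complex_ofReal, φ.integral_normed, Complex.ofReal_one]
    · refine (integrable_cbump φ).mul_bdd (c := 1) ?_
        (ae_of_all _ fun z => (Circle.norm_coe _).le)
      refine Continuous.aestronglyMeasurable ?_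
      simp only [Real.fourierChar_apply]
      fun_prop
  rw [e1]
  have e2 : ∀ x, ‖cbump φ x * (1 - (𝐞 (-⟪x, ξ⟫) : ℂ))‖ ≤
      φ.normed volume x * (2 * π * φ.rOut * ‖ξ‖) := fun x => by
    rw [norm_mul, cbump, Complex.norm_real, Real.norm_of_nonneg (φ.nonneg_normed _)]
    by_cases hx : x ∈ ball (0 : V) φ.rOut
    · refine mul_le_mul_of_nonneg_left ?_ (φ.nonneg_normed _)
      rw [norm_sub_rev, Real.fourierChar_apply, mul_comm (Complex.ofReal _)]
      refine Real.norm_exp_I_mul_ofReal_sub_one_le.trans ?_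
      rw [mem_ball_zero_iff] at hx
      rw [norm_mul, norm_neg, Real.norm_of_nonneg (by positivity : 0 ≤ 2 * π), mul_assoc (2 * π)]
      gcongr
      exact (norm_inner_le_norm x ξ).trans (by gcongr)
    · have : φ.normed volume x = 0 := by
        rwa [← Function.notMem_support, φ.support_normed_eq]
      simp [this]
  calc _ ≤ ∫ x, φ.normed volume x * (2 * π * φ.rOut * ‖ξ‖) :=
        norm_integral_le_of_norm_le (φ.integrable_normed.mul_const _) (ae_of_all _ e2)
    _ = _ := by rw [integral_mul_const, φ.integral_normed, one_mul]

theorem integrable_fourier_of_contDiff {f : V → ℂ} (hs : HasCompactSupport f)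
    (hf : ContDiff ℝ (⊤ : ℕ∞) f) : Integrable (𝓕 f) :=
  (𝓕 (hs.toSchwartzMap hf) : SchwartzMap V ℂ).integrable

theorem integrable_fourier_cbump (φ : ContDiffBump (0 : V)) : Integrable (𝓕 (cbump φ)) := by
  refine integrable_fourier_of_contDiff ?_ ?_
  · exact φ.hasCompactSupport_normed.comp_left (g := Complex.ofReal) Complex.ofReal_zero
  · exact Complex.ofRealCLM.contDiff.comp φ.contDiff_normed

theorem integrable_fourier_cmollify (μ : Measure V) [IsFiniteMeasure μ]
    (φ : ContDiffBump (0 : V)) : Integrable (𝓕 (cmollify μ φ)) := by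
  have : 𝓕 (cmollify μ φ) = fun ξ => measFourier μ ξ * 𝓕 (cbump φ) ξ :=
    funext (fourier_cmollify μ φ)
  rw [this]
  exact (integrable_fourier_cbump φ).bdd_mul
    (continuous_measFourier μ).aestronglyMeasurable (ae_of_all _ (norm_measFourier_le μ))

/-- Plancherel, from self-adjointness of the transform applied to `f` and the conjugate of `𝓕 f`.
Inversion also bounds `f`, which makes it square integrable. -/
theorem lintegral_enorm_fourier_sq {f : V → ℂ} (hc : Continuous f) (hf : Integrable f)
    (hf' : Integrable (𝓕 f)) : ∫⁻ ξ, ‖𝓕 f ξ‖ₑ ^ 2 = ∫⁻ x, ‖f x‖ₑ ^ 2 := by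
  have conv : ∀ g : V → ℂ, Continuous g → Integrable g → (∃ M, ∀ x, ‖g x‖ ≤ M) →
      ∫⁻ x, ‖g x‖ₑ ^ 2 = ENNReal.ofReal (∫ x, g x * starRingEnd ℂ (g x)).re := by
    rintro g hgc hg ⟨M, hM⟩
    have hi : Integrable fun x => ‖g x‖ ^ 2 := by
      simp only [sq]
      exact hg.norm.mul_bdd hgc.norm.aestronglyMeasurable
        (ae_of_all _ fun x => (norm_norm _).le.trans (hM x))
    have : ∀ x, g x * starRingEnd ℂ (g x) = ((‖g x‖ ^ 2 : ℝ) : ℂ) := fun x => by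
      rw [Complex.mul_conj, Complex.normSq_eq_norm_sq]
    simp only [this]
    rw [integral_complex_ofReal, Complex.ofReal_re,
      ofReal_integral_eq_lintegral_ofReal hi (ae_of_all _ fun x => by positivity)]
    refine lintegral_congr fun x => ?_
    rw [ENNReal.ofReal_pow (norm_nonneg _), ofReal_norm]
  have hb : ∃ M, ∀ x, ‖f x‖ ≤ M := by
    refine ⟨∫ ξ, ‖𝓕 f ξ‖, fun x => ?_⟩
    rw [eq_integral_fourier_mul hc hf hf' x]
    refine (norm_integral_le_integral_norm _).trans (le_of_eq ?_)
    refine integral_congr_ae (ae_of_all _ fun ξ => ?_)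
    exact (norm_mul _ _).trans ((congrArg _ (Circle.norm_coe _)).trans (mul_one _))
  rw [conv _ (continuous_fourier_of_integrable hf) hf'
    ⟨_, VectorFourier.norm_fourierIntegral_le_integral_norm _ _ _ _⟩, conv f hc hf hb]
  congr 2
  have hg : Integrable fun ξ => starRingEnd ℂ (𝓕 f ξ) :=
    hf'.congr' (Complex.continuous_conj.comp
      (continuous_fourier_of_integrable hf)).aestronglyMeasurable
      (ae_of_all _ fun x => (RCLike.norm_conj _).symm)
  have h := VectorFourier.integral_fourierIntegral_smul_eq_flip (L := innerₗ V) (μ := volume)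
    (ν := volume) Real.continuous_fourierChar (by exact continuous_inner) hf hg
  simp only [smul_eq_mul] at h
  refine h.trans (integral_congr_ae (ae_of_all _ fun x => ?_))
  simp only
  congr 1
  rw [eq_integral_fourier_mul hc hf hf' x, ← integral_conj]
  simp only [VectorFourier.fourierIntegral, Circle.smul_def, smul_eq_mul, map_mul]
  refine integral_congr_ae (ae_of_all _ fun ξ => ?_)
  simp only [LinearMap.flip_apply, innerₗ_apply_apply, mul_comm, AddChar.map_neg_eq_inv,
    Circle.coe_inv_eq_conj, real_inner_comm]

end Mollify

end

noncomputable section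

/-! ### Uniform weighted `L²` and `L³` bounds for the transform of the measure. -/

section FourierBounds

set_option linter.unusedSectionVars false

open Real FourierTransform Module Metric
open scoped ENNReal RealInnerProductSpace

variable {V : Type*} [NormedAddCommGroup V] [InnerProductSpace ℝ V] [FiniteDimensional ℝ V]
  [MeasurableSpace V] [BorelSpace V]

/-- A measure of Fourier decay of order `1/3` that obeys a ball condition with an exponent within
`1/12` of the dimension. -/
structure IsNearlyFull (μ : Measure V) (C α : ℝ) : Prop where
  lt_dim : α < finrank ℝ V
  dim_lt : (finrank ℝ V : ℝ) - 1 / 12 < α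
  ball_le : ∀ z ∈ μ.support, ∀ r : ℝ, 0 < r → r < 1 → μ.real (ball z r) ≤ C * r ^ α
  decay : ∀ ξ : V, ‖measFourier μ ξ‖ ≤ C * (1 + ‖ξ‖) ^ (-(1 / 3) : ℝ)

/-- The bump function at the origin which is `1` on the ball of radius `r / 2` and vanishes off the
ball of radius `r`. -/
def halfBump {r : ℝ} (hr : 0 < r) : ContDiffBump (0 : V) where
  rIn := r / 2
  rOut := r
  rIn_pos := by positivity
  rIn_lt_rOut := by linarith

variable {μ : Measure V} [IsFiniteMeasure μ] {C α : ℝ}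

theorem IsNearlyFull.mass_le (h : IsNearlyFull μ C α) : μ.real Set.univ ≤ C := by
  have := h.decay 0
  rw [measFourier_zero] at this
  simpa [abs_of_nonneg (measureReal_nonneg (μ := μ))] using this

theorem IsNearlyFull.nonneg (h : IsNearlyFull μ C α) : 0 ≤ C :=
  measureReal_nonneg.trans h.mass_le

variable (V) in
/-- The constant in the sup-norm bound for mollified measures. -/
def mollifyConst : ℝ := 4 ^ finrank ℝ V / volume.real (ball (0 : V) 1)

theorem unitBall_real_pos : 0 < volume.real (ball (0 : V) 1) := by
  rw [measureReal_def]
  exact ENNReal.toReal_pos (measure_ball_pos volume _ one_pos).ne' measure_ball_lt_top.ne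

theorem mollifyConst_pos : 0 < mollifyConst V := by
  have := unitBall_real_pos (V := V)
  unfold mollifyConst
  positivity

theorem IsNearlyFull.mollify_le (h : IsNearlyFull μ C α) {r : ℝ} (hr : 0 < r) (hr' : r < 1 / 2)
    (x : V) : mollify μ (halfBump hr) x ≤
      mollifyConst V * C * r ^ (-(finrank ℝ V - α)) := by
  have hC := h.nonneg
  have hv := unitBall_real_pos (V := V)
  have h1 := mollify_le_of_ball (φ := halfBump hr) (μ := μ) (B := C * (2 * r) ^ α)
    (by positivity) (fun z hz => h.ball_le z hz _ (by simp [halfBump, hr])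
      (by simp only [halfBump]; linarith)) x
  refine h1.trans ?_
  have h2 : (2 * r) ^ α ≤ 2 ^ finrank ℝ V * r ^ α := by
    rw [mul_rpow zero_le_two hr.le, ← rpow_natCast 2]
    gcongr
    · norm_num
    · exact h.lt_dim.le
  have h3 : r ^ (-(finrank ℝ V - α)) = r ^ α / r ^ finrank ℝ V := by
    rw [neg_sub, rpow_sub hr, rpow_natCast]
  rw [Measure.addHaar_real_closedBall _ _ (halfBump hr).rIn_pos.le, h3]
  have e4 : (4 : ℝ) ^ finrank ℝ V = 2 ^ finrank ℝ V * 2 ^ finrank ℝ V := by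
    rw [← mul_pow]; norm_num
  calc _ ≤ 1 / ((halfBump (V := V) hr).rIn ^ finrank ℝ V * volume.real (ball (0 : V) 1)) *
          (C * (2 ^ finrank ℝ V * r ^ α)) := by
        have := (halfBump (V := V) hr).rIn_pos
        gcongr
    _ = _ := by
        simp only [halfBump, mollifyConst, e4, div_pow]
        field_simp

theorem lintegral_enorm_cmollify_sq_le {φ : ContDiffBump (0 : V)} {M : ℝ}
    (hM : ∀ x, mollify μ φ x ≤ M) :
    ∫⁻ x, ‖cmollify μ φ x‖ₑ ^ 2 ≤ ENNReal.ofReal (M * μ.real Set.univ) := by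
  have hM0 : 0 ≤ M := (mollify_nonneg μ φ 0).trans (hM 0)
  have he : ∀ x, ‖cmollify μ φ x‖ₑ = ENNReal.ofReal (mollify μ φ x) := fun x => by
    rw [cmollify, ← ofReal_norm, Complex.norm_real, Real.norm_of_nonneg (mollify_nonneg μ φ x)]
  rw [ENNReal.ofReal_mul hM0, ← integral_mollify μ φ,
    ofReal_integral_eq_lintegral_ofReal (integrable_mollify μ φ)
      (ae_of_all _ (mollify_nonneg μ φ)),
    ← lintegral_const_mul _ (continuous_mollify μ φ).measurable.ennreal_ofReal]
  refine lintegral_mono fun x => ?_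
  rw [he, sq]
  gcongr
  exact hM x

/-- Mollifying at scale about `1 / T` changes the transform on this ball by at most a factor `2`.
Plancherel reduces to the `L²` norm of the mollification, which is at most its supremum times its
mass; the supremum costs `T ^ (n - α) ≲ T ^ (1 / 12)`. -/
theorem IsNearlyFull.lintegral_closedBall_le (h : IsNearlyFull μ C α) {T : ℝ} (hT : 1 ≤ T) :
    ∫⁻ ξ in closedBall (0 : V) T, ‖measFourier μ ξ‖ₑ ^ 2 ≤
      ENNReal.ofReal (16 * π * mollifyConst V * C ^ 2 * T ^ (1 / 12 : ℝ)) := by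
  have hC := h.nonneg
  have hK := mollifyConst_pos (V := V)
  have hπ := Real.pi_gt_three
  have hT0 : 0 < T := by linarith
  -- Makes `2 π r T = 1 / 2`, so the bump's transform has modulus at least `1 / 2` on the ball.
  set r : ℝ := 1 / (4 * π * T) with hr
  have hr0 : 0 < r := by positivity
  have hr1 : r < 1 / 2 := by
    rw [hr]
    apply one_div_lt_one_div_of_lt (by norm_num)
    nlinarith
  set φ : ContDiffBump (0 : V) := halfBump hr0 with hφ
  have hpt : ∀ ξ ∈ closedBall (0 : V) T,
      ‖measFourier μ ξ‖ₑ ^ 2 ≤ 4 * ‖𝓕 (cmollify μ φ) ξ‖ₑ ^ 2 := fun ξ hξ => by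
    rw [mem_closedBall_zero_iff] at hξ
    have h1 : ‖1 - 𝓕 (cbump φ) ξ‖ ≤ 1 / 2 := by
      refine (norm_one_sub_fourier_cbump_le φ ξ).trans ?_
      have : φ.rOut = r := rfl
      rw [this]
      calc 2 * π * r * ‖ξ‖ ≤ 2 * π * r * T := by gcongr
        _ = 1 / 2 := by rw [hr]; field_simp; norm_num
    have h2 : 1 / 2 ≤ ‖𝓕 (cbump φ) ξ‖ := by
      have := norm_sub_norm_le (1 : ℂ) (1 - 𝓕 (cbump φ) ξ)
      rw [sub_sub_cancel, norm_one] at this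
      linarith
    have h3 : ‖measFourier μ ξ‖ ≤ 2 * ‖𝓕 (cmollify μ φ) ξ‖ := by
      rw [fourier_cmollify, norm_mul]
      nlinarith [norm_nonneg (measFourier μ ξ)]
    have h4 : ‖measFourier μ ξ‖ₑ ≤ 2 * ‖𝓕 (cmollify μ φ) ξ‖ₑ := by
      rw [← ofReal_norm, ← ofReal_norm]
      refine (ENNReal.ofReal_le_ofReal h3).trans (le_of_eq ?_)
      rw [ENNReal.ofReal_mul zero_le_two, ENNReal.ofReal_ofNat]
    calc _ ≤ (2 * ‖𝓕 (cmollify μ φ) ξ‖ₑ) ^ 2 := by gcongr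
      _ = _ := by rw [mul_pow]; norm_num
  have hexp : r ^ (-(finrank ℝ V - α)) ≤ 4 * π * T ^ (1 / 12 : ℝ) := by
    have e : r ^ (-(finrank ℝ V - α)) = (4 * π * T) ^ (finrank ℝ V - α) := by
      rw [hr, one_div, inv_rpow (by positivity), rpow_neg (by positivity), inv_inv]
    have hd := h.dim_lt
    rw [e]
    calc (4 * π * T) ^ (finrank ℝ V - α) ≤ (4 * π * T) ^ (1 / 12 : ℝ) :=
          rpow_le_rpow_of_exponent_le (by nlinarith) (by linarith)
      _ = (4 * π) ^ (1 / 12 : ℝ) * T ^ (1 / 12 : ℝ) := mul_rpow (by positivity) hT0.le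
      _ ≤ (4 * π) ^ (1 : ℝ) * T ^ (1 / 12 : ℝ) := by
          gcongr
          · linarith
          · norm_num
      _ = _ := by rw [rpow_one]
  calc _ ≤ ∫⁻ ξ in closedBall (0 : V) T, 4 * ‖𝓕 (cmollify μ φ) ξ‖ₑ ^ 2 :=
        setLIntegral_mono' measurableSet_closedBall hpt
    _ ≤ ∫⁻ ξ, 4 * ‖𝓕 (cmollify μ φ) ξ‖ₑ ^ 2 := setLIntegral_le_lintegral _ _
    _ = 4 * ∫⁻ x, ‖cmollify μ φ x‖ₑ ^ 2 := by
        rw [lintegral_const_mul' _ _ (by norm_num), lintegral_enorm_fourier_sq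
          (continuous_cmollify μ φ) (integrable_cmollify μ φ) (integrable_fourier_cmollify μ φ)]
    _ ≤ 4 * ENNReal.ofReal
          (mollifyConst V * C * r ^ (-(finrank ℝ V - α)) * μ.real Set.univ) := by
        gcongr
        exact lintegral_enorm_cmollify_sq_le (h.mollify_le hr0 hr1)
    _ ≤ 4 * ENNReal.ofReal (mollifyConst V * C * (4 * π * T ^ (1 / 12 : ℝ)) * C) := by
        gcongr
        exact h.mass_le
    _ = _ := by
        rw [← ENNReal.ofReal_ofNat, ← ENNReal.ofReal_mul (by norm_num)]
        congr 1
        ring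

variable (V) in
theorem exists_lintegral_sq_weight_le (C : ℝ) : ∃ Q : ℝ, 0 ≤ Q ∧
    ∀ (μ : Measure V) [IsFiniteMeasure μ] (α : ℝ), IsNearlyFull μ C α →
      ∫⁻ ξ, ‖measFourier μ ξ‖ₑ ^ 2 * ENNReal.ofReal ((1 + ‖ξ‖) ^ (-(1 / 4) : ℝ)) ≤
        ENNReal.ofReal Q := by
  -- Dyadic ratio: the weight gives `2 ^ (-1/4)` and the ball estimate costs `2 ^ (1/12)`.
  set q : ℝ := 2 ^ (-(1 / 6) : ℝ) with hq
  have hq0 : 0 < q := by positivity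
  have hq1 : q < 1 := rpow_lt_one_of_one_lt_of_neg one_lt_two (by norm_num)
  have hK := mollifyConst_pos (V := V)
  set K₁ : ℝ := 16 * π * mollifyConst V * C ^ 2 with hK₁
  have hK₁0 : 0 ≤ K₁ := by positivity
  have hs : Summable fun k : ℕ => K₁ * 2 * q ^ k :=
    (summable_geometric_of_lt_one hq0.le hq1).mul_left _
  refine ⟨∑' k : ℕ, K₁ * 2 * q ^ k, tsum_nonneg fun k => by positivity, fun μ _ α h => ?_⟩
  have hm : Measurable fun ξ => ‖measFourier μ ξ‖ₑ ^ 2 :=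
    (continuous_measFourier μ).enorm.measurable.pow_const 2
  have hpt : ∀ ξ, ‖measFourier μ ξ‖ₑ ^ 2 * ENNReal.ofReal ((1 + ‖ξ‖) ^ (-(1 / 4) : ℝ)) ≤
      ∑' k : ℕ, ENNReal.ofReal (((2 : ℝ) ^ k) ^ (-(1 / 4) : ℝ)) *
        (closedBall (0 : V) (2 ^ (k + 1))).indicator (fun ξ => ‖measFourier μ ξ‖ₑ ^ 2) ξ := by
    intro ξ
    obtain ⟨k, hk1, hk2⟩ := exists_nat_pow_near (show (1 : ℝ) ≤ 1 + ‖ξ‖ by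
      linarith [norm_nonneg ξ]) one_lt_two
    refine le_trans ?_ (ENNReal.le_tsum k)
    rw [Set.indicator_of_mem (by rw [mem_closedBall_zero_iff]; linarith [norm_nonneg ξ]), mul_comm]
    gcongr ENNReal.ofReal ?_ * _
    exact rpow_le_rpow_of_nonpos (by positivity) hk1 (by norm_num)
  refine (lintegral_mono hpt).trans ?_
  rw [lintegral_tsum fun k => ((hm.indicator measurableSet_closedBall).const_mul _).aemeasurable,
    ENNReal.ofReal_tsum_of_nonneg (fun k => by positivity) hs]
  refine ENNReal.tsum_le_tsum fun k => ?_
  rw [lintegral_const_mul _ (hm.indicator measurableSet_closedBall),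
    lintegral_indicator measurableSet_closedBall]
  refine (mul_le_mul_right (h.lintegral_closedBall_le (one_le_pow₀ one_le_two)) _).trans ?_
  rw [← ENNReal.ofReal_mul (by positivity)]
  refine ENNReal.ofReal_le_ofReal ?_
  have e1 : ((2 : ℝ) ^ k) ^ (-(1 / 4) : ℝ) = 2 ^ (-(1 / 4) * k : ℝ) := by
    rw [← rpow_natCast, ← rpow_mul zero_le_two]; ring_nf
  have e2 : ((2 : ℝ) ^ (k + 1)) ^ (1 / 12 : ℝ) = 2 ^ (1 / 12 * k : ℝ) * 2 ^ (1 / 12 : ℝ) := by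
    rw [← rpow_natCast, ← rpow_mul zero_le_two, ← rpow_add zero_lt_two]; push_cast; ring_nf
  have e3 : q ^ k = 2 ^ (-(1 / 4) * k : ℝ) * 2 ^ (1 / 12 * k : ℝ) := by
    rw [hq, ← rpow_natCast, ← rpow_mul zero_le_two, ← rpow_add zero_lt_two]; ring_nf
  have e4 : (2 : ℝ) ^ (1 / 12 : ℝ) ≤ 2 := by
    calc (2 : ℝ) ^ (1 / 12 : ℝ) ≤ 2 ^ (1 : ℝ) :=
          rpow_le_rpow_of_exponent_le one_le_two (by norm_num)
      _ = 2 := rpow_one _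
  rw [← hK₁, e1, e2, e3]
  calc _ = K₁ * 2 ^ (1 / 12 : ℝ) * (2 ^ (-(1 / 4) * k : ℝ) * 2 ^ (1 / 12 * k : ℝ)) := by ring
    _ ≤ _ := by gcongr

variable (V) in
-- One factor of the cube is spent on decay: `-1/3 + 1/12 = -1/4` is exactly the weight of the `L²`
-- estimate. The positive weight left over gives smallness when scales are compared.
theorem exists_lintegral_cube_weight_le (C : ℝ) : ∃ Q : ℝ, 0 ≤ Q ∧
    ∀ (μ : Measure V) [IsFiniteMeasure μ] (α : ℝ), IsNearlyFull μ C α →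
      ∫⁻ ξ, ‖measFourier μ ξ‖ₑ ^ 3 * ENNReal.ofReal ((1 + ‖ξ‖) ^ (1 / 12 : ℝ)) ≤
        ENNReal.ofReal Q := by
  obtain ⟨Q, hQ0, hQ⟩ := exists_lintegral_sq_weight_le V C
  by_cases hC : 0 ≤ C
  swap
  · exact ⟨0, le_rfl, fun μ _ α h => absurd h.nonneg hC⟩
  refine ⟨C * Q, by positivity, fun μ _ α h => ?_⟩
  rw [ENNReal.ofReal_mul hC]
  refine le_trans ?_ (mul_le_mul_right (hQ μ α h) _)
  rw [← lintegral_const_mul' _ _ ENNReal.ofReal_ne_top]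
  refine lintegral_mono fun ξ => ?_
  have hx : 0 < 1 + ‖ξ‖ := by positivity
  have h1 : ‖measFourier μ ξ‖ₑ ≤ ENNReal.ofReal (C * (1 + ‖ξ‖) ^ (-(1 / 3) : ℝ)) := by
    rw [← ofReal_norm]; exact ENNReal.ofReal_le_ofReal (h.decay ξ)
  calc _ = ‖measFourier μ ξ‖ₑ * ENNReal.ofReal ((1 + ‖ξ‖) ^ (1 / 12 : ℝ)) *
          ‖measFourier μ ξ‖ₑ ^ 2 := by ring
    _ ≤ ENNReal.ofReal (C * (1 + ‖ξ‖) ^ (-(1 / 3) : ℝ)) *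
          ENNReal.ofReal ((1 + ‖ξ‖) ^ (1 / 12 : ℝ)) * ‖measFourier μ ξ‖ₑ ^ 2 := by gcongr
    _ = _ := by
        rw [← ENNReal.ofReal_mul (by positivity), mul_assoc C, ← rpow_add hx,
          ENNReal.ofReal_mul hC]
        norm_num
        ring

theorem lintegral_fourier_cmollify_cube_le {Q : ℝ}
    (hQ : ∫⁻ ξ, ‖measFourier μ ξ‖ₑ ^ 3 * ENNReal.ofReal ((1 + ‖ξ‖) ^ (1 / 12 : ℝ)) ≤
      ENNReal.ofReal Q) (φ : ContDiffBump (0 : V)) :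
    ∫⁻ ξ, ‖𝓕 (cmollify μ φ) ξ‖ₑ ^ 3 ≤ ENNReal.ofReal Q := by
  refine le_trans (lintegral_mono fun ξ => ?_) hQ
  have h1 : ‖𝓕 (cmollify μ φ) ξ‖ₑ ≤ ‖measFourier μ ξ‖ₑ := by
    rw [fourier_cmollify, enorm_mul]
    refine mul_le_of_le_one_right' ?_
    rw [← ofReal_norm]
    exact ENNReal.ofReal_le_one.2 (norm_fourier_cbump_le_one φ ξ)
  have h2 : 1 ≤ ENNReal.ofReal ((1 + ‖ξ‖) ^ (1 / 12 : ℝ)) :=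
    ENNReal.one_le_ofReal.2 (one_le_rpow (by linarith [norm_nonneg ξ]) (by norm_num))
  calc _ ≤ ‖measFourier μ ξ‖ₑ ^ 3 := by gcongr
    _ ≤ _ := le_mul_of_one_le_right' h2

/-- The two bump transforms differ by at most `2 min (1, y)` with `y = 2 π ψ.rOut ‖ξ‖`, and `min (1,
y) ^ 3 ≤ y ^ (1/12)`, which the weight absorbs. Only the larger scale enters the bound. -/
theorem lintegral_fourier_cmollify_sub_cube_le {Q : ℝ}
    (hQ : ∫⁻ ξ, ‖measFourier μ ξ‖ₑ ^ 3 * ENNReal.ofReal ((1 + ‖ξ‖) ^ (1 / 12 : ℝ)) ≤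
      ENNReal.ofReal Q) {φ ψ : ContDiffBump (0 : V)} (h : φ.rOut ≤ ψ.rOut) :
    ∫⁻ ξ, ‖𝓕 (fun x => cmollify μ φ x - cmollify μ ψ x) ξ‖ₑ ^ 3 ≤
      ENNReal.ofReal (8 * (2 * π * ψ.rOut) ^ (1 / 12 : ℝ) * Q) := by
  have hψ := ψ.rOut_pos
  rw [ENNReal.ofReal_mul (by positivity)]
  refine le_trans ?_ (mul_le_mul_right hQ _)
  rw [← lintegral_const_mul' _ _ ENNReal.ofReal_ne_top]
  refine lintegral_mono fun ξ => ?_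
  set y : ℝ := 2 * π * ψ.rOut * ‖ξ‖ with hy
  have hy0 : 0 ≤ y := by positivity
  have e1 : 𝓕 (fun x => cmollify μ φ x - cmollify μ ψ x) ξ =
      measFourier μ ξ * (𝓕 (cbump φ) ξ - 𝓕 (cbump ψ) ξ) := by
    rw [mul_sub, ← fourier_cmollify, ← fourier_cmollify]
    simp only [Real.fourier_eq, smul_sub]
    exact integral_sub ((Real.fourierIntegral_convergent_iff ξ).2 (integrable_cmollify μ φ))
      ((Real.fourierIntegral_convergent_iff ξ).2 (integrable_cmollify μ ψ))
  have h1 : ‖𝓕 (cbump φ) ξ - 𝓕 (cbump ψ) ξ‖ ≤ 2 * min 1 y := by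
    rw [mul_min_of_nonneg _ _ zero_le_two]
    refine le_min ?_ ?_
    · have := norm_sub_le (𝓕 (cbump φ) ξ) (𝓕 (cbump ψ) ξ)
      linarith [norm_fourier_cbump_le_one φ ξ, norm_fourier_cbump_le_one ψ ξ]
    · have e : 𝓕 (cbump φ) ξ - 𝓕 (cbump ψ) ξ =
          (1 - 𝓕 (cbump ψ) ξ) - (1 - 𝓕 (cbump φ) ξ) := by ring
      rw [e]
      refine (norm_sub_le _ _).trans ?_
      have h2 := norm_one_sub_fourier_cbump_le ψ ξ
      have h3 : 2 * π * φ.rOut * ‖ξ‖ ≤ y := by rw [hy]; gcongr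
      linarith [norm_one_sub_fourier_cbump_le φ ξ]
  have h2 : ‖𝓕 (cbump φ) ξ - 𝓕 (cbump ψ) ξ‖ ^ 3 ≤
      8 * (2 * π * ψ.rOut) ^ (1 / 12 : ℝ) * (1 + ‖ξ‖) ^ (1 / 12 : ℝ) := by
    have h3 : (min 1 y) ^ 3 ≤ y ^ (1 / 12 : ℝ) := by
      have hm0 : 0 ≤ min 1 y := le_min zero_le_one hy0
      calc (min 1 y) ^ 3 = (min 1 y) ^ (3 : ℝ) := by norm_cast
        _ ≤ (min 1 y) ^ (1 / 12 : ℝ) :=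
            rpow_le_rpow_of_exponent_ge' hm0 (min_le_left _ _) (by norm_num) (by norm_num)
        _ ≤ _ := rpow_le_rpow hm0 (min_le_right _ _) (by norm_num)
    calc _ ≤ (2 * min 1 y) ^ 3 := by gcongr
      _ = 8 * (min 1 y) ^ 3 := by ring
      _ ≤ 8 * y ^ (1 / 12 : ℝ) := by gcongr
      _ = 8 * (2 * π * ψ.rOut) ^ (1 / 12 : ℝ) * ‖ξ‖ ^ (1 / 12 : ℝ) := by
          rw [hy, mul_rpow (by positivity) (norm_nonneg _)]; ring
      _ ≤ _ := by gcongr; linarith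
  have h4 : ‖𝓕 (cbump φ) ξ - 𝓕 (cbump ψ) ξ‖ₑ ^ 3 ≤
      ENNReal.ofReal (8 * (2 * π * ψ.rOut) ^ (1 / 12 : ℝ)) *
        ENNReal.ofReal ((1 + ‖ξ‖) ^ (1 / 12 : ℝ)) := by
    rw [← ENNReal.ofReal_mul (by positivity), ← ofReal_norm,
      ← ENNReal.ofReal_pow (norm_nonneg _)]
    exact ENNReal.ofReal_le_ofReal h2
  rw [e1, enorm_mul, mul_pow]
  calc _ ≤ ‖measFourier μ ξ‖ₑ ^ 3 * _ := mul_le_mul_right h4 _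
    _ = _ := by ring

end FourierBounds

end

noncomputable section

/-! ### The smoothly weighted pattern form: stability in scale, lower bound, compactness. -/

section PatternForm

set_option linter.unusedSectionVars false

open Real FourierTransform Module Metric Filter Topology
open scoped ENNReal RealInnerProductSpace

variable {V : Type*} [NormedAddCommGroup V] [InnerProductSpace ℝ V] [FiniteDimensional ℝ V]
  [MeasurableSpace V] [BorelSpace V]

variable (V) in
theorem exists_annulus_weight {κ ρ : ℝ} (hκ : 0 < κ) (hκρ : κ < ρ) :
    ∃ W : V → ℝ, Continuous W ∧ HasCompactSupport W ∧ (∀ y, 0 ≤ W y) ∧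
      (∀ y, κ ≤ ‖y‖ → ‖y‖ ≤ ρ → W y = 1) ∧ (∀ y, W y ≠ 0 → κ / 2 ≤ ‖y‖) ∧
      Integrable (𝓕 fun y => (W y : ℂ)) := by
  let ψ₁ : ContDiffBump (0 : V) := ⟨ρ, ρ + 1, by linarith, by linarith⟩
  let ψ₂ : ContDiffBump (0 : V) := ⟨κ / 2, κ, by linarith, by linarith⟩
  have hs : HasCompactSupport fun y => ψ₁ y - ψ₂ y := ψ₁.hasCompactSupport.sub ψ₂.hasCompactSupport
  refine ⟨fun y => ψ₁ y - ψ₂ y, ψ₁.continuous.sub ψ₂.continuous, hs, fun y => ?_,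
    fun y hy1 hy2 => ?_, fun y hy => ?_, ?_⟩
  · change 0 ≤ ψ₁ y - ψ₂ y
    by_cases hy : ‖y‖ ≤ ρ
    · have : ψ₁ y = 1 := ψ₁.one_of_mem_closedBall (by simpa [ψ₁] using hy)
      rw [this, sub_nonneg]
      exact ψ₂.le_one
    · have : ψ₂ y = 0 := ψ₂.zero_of_le_dist (by simp only [dist_zero_right, ψ₂]; linarith)
      rw [this, sub_zero]
      exact ψ₁.nonneg
  · have h1 : ψ₁ y = 1 := ψ₁.one_of_mem_closedBall (by simpa [ψ₁] using hy2)
    have h2 : ψ₂ y = 0 := ψ₂.zero_of_le_dist (by simpa [ψ₂] using hy1)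
    simp only [h1, h2, sub_zero]
  · by_contra! hlt
    have h1 : ψ₁ y = 1 :=
      ψ₁.one_of_mem_closedBall (by simp only [mem_closedBall, dist_zero_right, ψ₁]; linarith)
    have h2 : ψ₂ y = 1 := ψ₂.one_of_mem_closedBall (by simpa [ψ₂] using hlt.le)
    simp only [h1, h2, sub_self, ne_eq, not_true_eq_false] at hy
  · refine integrable_fourier_of_contDiff (hs.comp_left (g := Complex.ofReal) Complex.ofReal_zero) ?_
    exact Complex.ofRealCLM.contDiff.comp (ψ₁.contDiff.sub ψ₂.contDiff)

/-- The weighted trilinear form counting the patterns `x`, `x + y`, `x + t • y`. -/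
def patternForm (t : ℝ) (w f₀ f₁ f₂ : V → ℂ) : ℂ :=
  ∫ p : V × V, f₀ p.1 * f₁ (p.1 + p.2) * f₂ (p.1 + t • p.2) * w p.2

theorem integrable_pattern (t : ℝ) {w f₀ f₁ f₂ : V → ℂ} {M N : ℝ} (h₀ : Integrable f₀)
    (h₁ : Integrable f₁) (h₂c : Continuous f₂) (h₂ : ∀ x, ‖f₂ x‖ ≤ M)
    (hwc : Continuous w) (hw : ∀ x, ‖w x‖ ≤ N) :
    Integrable fun p : V × V => f₀ p.1 * f₁ (p.1 + p.2) * f₂ (p.1 + t • p.2) * w p.2 := by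
  have hmp : MeasurePreserving (MeasurableEquiv.shearAddRight V) volume volume :=
    measurePreserving_prod_add (volume : Measure V) (volume : Measure V)
  have h01 : Integrable fun p : V × V => f₀ p.1 * f₁ (p.1 + p.2) :=
    hmp.integrable_comp_of_integrable (h₀.mul_prod h₁)
  refine (h01.mul_bdd ?_ (ae_of_all _ fun p => h₂ (p.1 + t • p.2))).mul_bdd ?_
    (ae_of_all _ fun p => hw p.2)
  · exact (h₂c.comp (by fun_prop)).aestronglyMeasurable
  · exact (hwc.comp (by fun_prop)).aestronglyMeasurable

variable (V) in
/-- The constant in the bound for `patternForm`. -/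
def patternFormConst (t : ℝ) (w : V → ℂ) : ℝ≥0∞ :=
  (∫⁻ ζ, ‖𝓕 w ζ‖ₑ) * (ENNReal.ofReal |((t - 1) ^ finrank ℝ V)⁻¹| ^ (1 / 3 : ℝ) *
    ENNReal.ofReal |((-t) ^ finrank ℝ V)⁻¹| ^ (1 / 3 : ℝ))

theorem patternFormConst_ne_top (t : ℝ) {w : V → ℂ} (hw : Integrable (𝓕 w)) :
    patternFormConst V t w ≠ ⊤ := by
  refine ENNReal.mul_ne_top hw.2.ne (ENNReal.mul_ne_top ?_ ?_) <;>
  exact ENNReal.rpow_ne_top_of_nonneg (by norm_num) ENNReal.ofReal_ne_top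

theorem enorm_patternForm_le {t : ℝ} (ht0 : t ≠ 0) (ht1 : t ≠ 1) {w f₀ f₁ f₂ : V → ℂ}
    {X₀ X₁ X₂ : ℝ≥0∞}
    (h₀ : Integrable f₀) (h₁ : Integrable f₁) (h₂ : Integrable f₂) (hw : Integrable w)
    (h₂c : Continuous f₂) (hwc : Continuous w) (h₂' : Integrable (𝓕 f₂))
    (hw' : Integrable (𝓕 w)) (hX₀ : ∫⁻ ξ, ‖𝓕 f₀ ξ‖ₑ ^ 3 ≤ X₀)
    (hX₁ : ∫⁻ ξ, ‖𝓕 f₁ ξ‖ₑ ^ 3 ≤ X₁) (hX₂ : ∫⁻ ξ, ‖𝓕 f₂ ξ‖ₑ ^ 3 ≤ X₂) :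
    ‖patternForm t w f₀ f₁ f₂‖ₑ ≤ patternFormConst V t w *
      (X₀ ^ (1 / 3 : ℝ) * X₁ ^ (1 / 3 : ℝ) * X₂ ^ (1 / 3 : ℝ)) := by
  refine (enorm_integral_pattern_le ht0 ht1 h₀ h₁ h₂ hw h₂c hwc h₂' hw').trans ?_
  rw [ENNReal.mul_rpow_of_nonneg _ _ (by norm_num), ENNReal.mul_rpow_of_nonneg _ _ (by norm_num)]
  calc _ ≤ (∫⁻ ζ, ‖𝓕 w ζ‖ₑ) * (X₂ ^ (1 / 3 : ℝ) *
        (ENNReal.ofReal |((t - 1) ^ finrank ℝ V)⁻¹| ^ (1 / 3 : ℝ) * X₀ ^ (1 / 3 : ℝ)) *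
        (ENNReal.ofReal |((-t) ^ finrank ℝ V)⁻¹| ^ (1 / 3 : ℝ) * X₁ ^ (1 / 3 : ℝ))) := by gcongr
    _ = _ := by rw [patternFormConst]; ring

theorem exists_norm_cmollify_le (μ : Measure V) [IsFiniteMeasure μ] (φ : ContDiffBump (0 : V)) :
    ∃ M, ∀ x, ‖cmollify μ φ x‖ ≤ M := by
  refine ⟨1 / volume.real (closedBall (0 : V) φ.rIn) * μ.real Set.univ, fun x => ?_⟩
  rw [cmollify, Complex.norm_real]
  exact norm_integral_le_of_norm_le_const (ae_of_all _ fun z => norm_normed_le φ _)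

/-- Telescoping writes the difference as three forms, each with one entry `f - g`. The bound does
not involve the smaller scale, so that scale can be sent to zero with the larger one fixed. -/
theorem enorm_patternForm_cmollify_sub_le {t : ℝ} (ht0 : t ≠ 0) (ht1 : t ≠ 1) {w : V → ℂ}
    (hwc : Continuous w) (hws : HasCompactSupport w) (hw' : Integrable (𝓕 w)) {μ : Measure V}
    [IsFiniteMeasure μ] {Q : ℝ}
    (hQ : ∫⁻ ξ, ‖measFourier μ ξ‖ₑ ^ 3 * ENNReal.ofReal ((1 + ‖ξ‖) ^ (1 / 12 : ℝ)) ≤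
      ENNReal.ofReal Q) {φ ψ : ContDiffBump (0 : V)} (h : φ.rOut ≤ ψ.rOut) :
    ‖patternForm t w (cmollify μ φ) (cmollify μ φ) (cmollify μ φ) -
      patternForm t w (cmollify μ ψ) (cmollify μ ψ) (cmollify μ ψ)‖ₑ ≤
      3 * (patternFormConst V t w * (ENNReal.ofReal Q ^ (1 / 3 : ℝ) *
        ENNReal.ofReal Q ^ (1 / 3 : ℝ) *
        ENNReal.ofReal (8 * (2 * π * ψ.rOut) ^ (1 / 12 : ℝ) * Q) ^ (1 / 3 : ℝ))) := by
  set f := cmollify μ φ with hf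
  set g := cmollify μ ψ with hg
  set d : V → ℂ := fun x => f x - g x with hd
  have hw : Integrable w := hwc.integrable_of_hasCompactSupport hws
  obtain ⟨N, hN⟩ := hws.exists_bound_of_continuous hwc
  obtain ⟨Mf, hMf⟩ := exists_norm_cmollify_le μ φ
  obtain ⟨Mg, hMg⟩ := exists_norm_cmollify_le μ ψ
  have hfi : Integrable f := integrable_cmollify μ φ
  have hgi : Integrable g := integrable_cmollify μ ψ
  have hdi : Integrable d := hfi.sub hgi
  have hfc : Continuous f := continuous_cmollify μ φ
  have hgc : Continuous g := continuous_cmollify μ ψ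
  have hdc : Continuous d := hfc.sub hgc
  have hMd : ∀ x, ‖d x‖ ≤ Mf + Mg := fun x =>
    (norm_sub_le _ _).trans (add_le_add (hMf x) (hMg x))
  have hf' : Integrable (𝓕 f) := integrable_fourier_cmollify μ φ
  have hg' : Integrable (𝓕 g) := integrable_fourier_cmollify μ ψ
  have hd' : Integrable (𝓕 d) := by
    have : 𝓕 d = fun ξ => 𝓕 f ξ - 𝓕 g ξ := by
      ext ξ
      simp only [Real.fourier_eq, hd, smul_sub]
      exact integral_sub ((Real.fourierIntegral_convergent_iff ξ).2 hfi)
        ((Real.fourierIntegral_convergent_iff ξ).2 hgi)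
    rw [this]
    exact hf'.sub hg'
  have hfQ := lintegral_fourier_cmollify_cube_le hQ φ
  have hgQ := lintegral_fourier_cmollify_cube_le hQ ψ
  have hdQ := lintegral_fourier_cmollify_sub_cube_le hQ h
  have e : patternForm t w f f f - patternForm t w g g g =
      patternForm t w d f f + patternForm t w g d f + patternForm t w g g d := by
    have i1 := integrable_pattern t hfi hfi hfc hMf hwc hN
    have i2 := integrable_pattern t hgi hgi hgc hMg hwc hN
    have i3 := integrable_pattern t hdi hfi hfc hMf hwc hN
    have i4 := integrable_pattern t hgi hdi hfc hMf hwc hN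
    have i5 := integrable_pattern t hgi hgi hdc hMd hwc hN
    unfold patternForm
    rw [← integral_sub i1 i2, ← integral_add i3 i4, ← integral_add (by exact i3.add i4) i5]
    refine integral_congr_ae (ae_of_all _ fun p => ?_)
    simp only [hd]
    ring
  have b1 := enorm_patternForm_le ht0 ht1 hdi hfi hfi hw hfc hwc hf' hw' hdQ hfQ hfQ
  have b2 := enorm_patternForm_le ht0 ht1 hgi hdi hfi hw hfc hwc hf' hw' hgQ hdQ hfQ
  have b3 := enorm_patternForm_le ht0 ht1 hgi hgi hdi hw hdc hwc hd' hw' hgQ hgQ hdQ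
  rw [e]
  refine (enorm_add_le _ _).trans ((add_le_add_left (enorm_add_le _ _) _).trans
    ((add_le_add (add_le_add b1 b2) b3).trans (le_of_eq ?_)))
  ring

theorem ofReal_le_enorm_patternForm {t κ ρ c : ℝ} {W : V → ℝ} (hWc : Continuous W)
    (hWs : HasCompactSupport W) (hW0 : ∀ y, 0 ≤ W y)
    (hW1 : ∀ y, κ ≤ ‖y‖ → ‖y‖ ≤ ρ → W y = 1) {μ : Measure V} [IsFiniteMeasure μ]
    {φ : ContDiffBump (0 : V)}
    (h : ENNReal.ofReal c ≤ ∫⁻ y in {y : V | κ ≤ ‖y‖ ∧ ‖y‖ ≤ ρ},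
      ∫⁻ x, ENNReal.ofReal (mollify μ φ x * mollify μ φ (x + y) * mollify μ φ (x + t • y))) :
    ENNReal.ofReal c ≤
      ‖patternForm t (fun y => (W y : ℂ)) (cmollify μ φ) (cmollify μ φ) (cmollify μ φ)‖ₑ := by
  set f := mollify μ φ with hf
  have hf0 : ∀ x, 0 ≤ f x := mollify_nonneg μ φ
  have hfc : Continuous f := continuous_mollify μ φ
  set F : V × V → ℝ := fun p => f p.1 * f (p.1 + p.2) * f (p.1 + t • p.2) * W p.2 with hF
  have hF0 : ∀ p, 0 ≤ F p := fun p => by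
    have := hf0 p.1; have := hf0 (p.1 + p.2); have := hf0 (p.1 + t • p.2); have := hW0 p.2
    simp only [hF]; positivity
  have hFc : Continuous F := by simp only [hF]; fun_prop
  have hFe : ∀ p : V × V, cmollify μ φ p.1 * cmollify μ φ (p.1 + p.2) *
      cmollify μ φ (p.1 + t • p.2) * (W p.2 : ℂ) = (F p : ℂ) := fun p => by
    simp only [hF, cmollify]; push_cast; ring
  obtain ⟨M, hM⟩ := exists_norm_cmollify_le μ φ
  obtain ⟨N, hN⟩ := hWs.exists_bound_of_continuous hWc
  have hFi : Integrable F := by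
    have := integrable_pattern t (w := fun y => (W y : ℂ)) (integrable_cmollify μ φ)
      (integrable_cmollify μ φ) (continuous_cmollify μ φ) hM
      (Complex.continuous_ofReal.comp hWc) (N := N) (fun x => by simpa using hN x)
    simp only [hFe] at this
    simpa using this.re
  have e1 : ‖patternForm t (fun y => (W y : ℂ)) (cmollify μ φ) (cmollify μ φ) (cmollify μ φ)‖ₑ =
      ∫⁻ p, ENNReal.ofReal (F p) := by
    unfold patternForm
    simp only [hFe]
    rw [integral_complex_ofReal, ← ofReal_norm, Complex.norm_real,
      Real.norm_of_nonneg (integral_nonneg hF0),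
      ofReal_integral_eq_lintegral_ofReal hFi (ae_of_all _ hF0)]
  rw [e1, Measure.volume_eq_prod, lintegral_prod_symm _ hFc.measurable.ennreal_ofReal.aemeasurable]
  have hSm : MeasurableSet {y : V | κ ≤ ‖y‖ ∧ ‖y‖ ≤ ρ} :=
    (measurableSet_le measurable_const measurable_norm).inter
      (measurableSet_le measurable_norm measurable_const)
  refine h.trans ((setLIntegral_mono' hSm fun y hy => lintegral_mono fun x => ?_).trans
    (setLIntegral_le_lintegral _ _))
  simp only [hF, hW1 y hy.1 hy.2, mul_one, le_refl]

/-- The sum of the three distances to `K` is continuous on a compact set of pairs `(x, y)`, so its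
infimum `0` is attained. The constraint `κ ≤ ‖y‖` survives the limit and prevents collapse. -/
theorem exists_pattern_of_approx {K : Set V} (hK : IsCompact K) {t κ ρ : ℝ}
    (h : ∀ s : ℝ, 0 < s → ∃ x y : V, κ ≤ ‖y‖ ∧ ‖y‖ ≤ ρ ∧ (∃ z ∈ K, dist z x < s) ∧
      (∃ z ∈ K, dist z (x + y) < s) ∧ ∃ z ∈ K, dist z (x + t • y) < s) :
    ∃ x y : V, κ ≤ ‖y‖ ∧ x ∈ K ∧ x + y ∈ K ∧ x + t • y ∈ K := by
  have hKne : K.Nonempty := by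
    obtain ⟨x, y, -, -, ⟨z, hz, -⟩, -⟩ := h 1 one_pos
    exact ⟨z, hz⟩
  set S : Set (V × V) := cthickening 1 K ×ˢ (closedBall (0 : V) ρ ∩ {y | κ ≤ ‖y‖}) with hS
  have hSc : IsCompact S := hK.cthickening.prod
    ((isCompact_closedBall _ _).inter_right (isClosed_le continuous_const continuous_norm))
  set G : V × V → ℝ := fun p =>
    infDist p.1 K + infDist (p.1 + p.2) K + infDist (p.1 + t • p.2) K with hG
  have hGc : Continuous G := by
    have := continuous_infDist_pt K
    simp only [hG]
    exact ((this.comp continuous_fst).add (this.comp (by fun_prop))).add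
      (this.comp (by fun_prop))
  have key : ∀ s : ℝ, 0 < s → s ≤ 1 → ∃ p ∈ S, G p ≤ 3 * s := fun s hs hs1 => by
    obtain ⟨x, y, hy1, hy2, ⟨z₀, hz₀, h₀⟩, ⟨z₁, hz₁, h₁⟩, ⟨z₂, hz₂, h₂⟩⟩ := h s hs
    refine ⟨(x, y), ⟨?_, by simpa using hy2, hy1⟩, ?_⟩
    · exact mem_cthickening_of_dist_le x z₀ 1 K hz₀ (by rw [dist_comm]; linarith)
    · have i0 := infDist_le_dist_of_mem (x := x) hz₀
      have i1 := infDist_le_dist_of_mem (x := x + y) hz₁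
      have i2 := infDist_le_dist_of_mem (x := x + t • y) hz₂
      rw [dist_comm] at i0 i1 i2
      simp only [hG]
      linarith
  obtain ⟨p₁, hp₁, -⟩ := key 1 one_pos le_rfl
  obtain ⟨p, hpS, hp⟩ := hSc.exists_isMinOn ⟨p₁, hp₁⟩ hGc.continuousOn
  have hG0 : G p ≤ 0 := by
    refine le_of_forall_pos_le_add fun ε hε => ?_
    obtain ⟨q, hq, hq'⟩ := key (min 1 (ε / 3)) (lt_min one_pos (by positivity)) (min_le_left _ _)
    have h1 : G p ≤ G q := hp hq
    have h2 := min_le_right 1 (ε / 3)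
    linarith
  have n0 := infDist_nonneg (x := p.1) (s := K)
  have n1 := infDist_nonneg (x := p.1 + p.2) (s := K)
  have n2 := infDist_nonneg (x := p.1 + t • p.2) (s := K)
  simp only [hG] at hG0
  have hmem : ∀ x, infDist x K ≤ 0 → x ∈ K := fun x hx =>
    (hK.isClosed.mem_iff_infDist_zero hKne).2 (le_antisymm hx infDist_nonneg)
  exact ⟨p.1, p.2, hpS.2.2, hmem _ (by linarith), hmem _ (by linarith), hmem _ (by linarith)⟩

end PatternForm

end

noncomputable section

/-! ### Choice of constants and patterns in the support of the measure. -/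

section SparsePatterns

set_option linter.unusedSectionVars false

open Real FourierTransform Module Metric Filter Topology
open scoped ENNReal RealInnerProductSpace

variable {V : Type*} [NormedAddCommGroup V] [InnerProductSpace ℝ V] [FiniteDimensional ℝ V]
  [MeasurableSpace V] [BorelSpace V]

theorem exists_small_scale {S c : ℝ≥0∞} (hS : S ≠ ⊤) (hc : 0 < c) (Q : ℝ) :
    ∃ r : ℝ, 0 < r ∧ r < 1 / 2 ∧
      3 * (S * (ENNReal.ofReal Q ^ (1 / 3 : ℝ) * ENNReal.ofReal Q ^ (1 / 3 : ℝ) *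
        ENNReal.ofReal (8 * (2 * π * r) ^ (1 / 12 : ℝ) * Q) ^ (1 / 3 : ℝ))) < c := by
  have hq : ENNReal.ofReal Q ^ (1 / 3 : ℝ) ≠ ⊤ :=
    ENNReal.rpow_ne_top_of_nonneg (by norm_num) ENNReal.ofReal_ne_top
  have h1 : Tendsto (fun r : ℝ => ENNReal.ofReal (8 * (2 * π * r) ^ (1 / 12 : ℝ) * Q))
      (𝓝 0) (𝓝 0) := by
    have hcont : Continuous fun r : ℝ => 8 * (2 * π * r) ^ (1 / 12 : ℝ) * Q := by
      refine (continuous_const.mul (Continuous.rpow_const (by fun_prop) ?_)).mul continuous_const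
      exact fun _ => Or.inr (by norm_num)
    have := (ENNReal.continuous_ofReal.comp hcont).tendsto 0
    simpa [Function.comp_def] using this
  have h2 := (ENNReal.continuous_rpow_const (y := (1 / 3 : ℝ))).continuousAt.tendsto.comp h1
  rw [ENNReal.zero_rpow_of_pos (by norm_num)] at h2
  have h3 := ENNReal.Tendsto.const_mul (a := (3 : ℝ≥0∞)) (ENNReal.Tendsto.const_mul (a := S)
    (ENNReal.Tendsto.const_mul
      (a := ENNReal.ofReal Q ^ (1 / 3 : ℝ) * ENNReal.ofReal Q ^ (1 / 3 : ℝ)) h2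
      (Or.inr (ENNReal.mul_ne_top hq hq))) (Or.inr hS)) (Or.inr (by norm_num))
  simp only [mul_zero] at h3
  have h4 := (h3.mono_left (nhdsWithin_le_nhds (s := Set.Ioi 0))).eventually_lt_const hc
  obtain ⟨r, ⟨hr, hr2⟩, hr0⟩ := ((h4.and (nhdsWithin_le_nhds
    (eventually_lt_nhds (show (0 : ℝ) < 1 / 2 by norm_num)))).and
    self_mem_nhdsWithin).exists
  exact ⟨r, hr0, hr2, hr⟩

theorem rpow_neg_le_two {r : ℝ} (hr : 0 < r) (hr1 : r < 1) {s : ℝ}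
    (hs : s ≤ log 2 / log (1 / r)) : r ^ (-s) ≤ 2 := by
  have hl : 0 < log (1 / r) := log_pos (by rw [lt_div_iff₀ hr]; linarith)
  have e : r ^ (-s) = exp (log (1 / r) * s) := by
    rw [rpow_def_of_pos hr, one_div, log_inv]; ring_nf
  rw [e]
  calc exp (log (1 / r) * s) ≤ exp (log (1 / r) * (log 2 / log (1 / r))) := by gcongr
    _ = 2 := by rw [mul_div_cancel₀ _ hl.ne', exp_log zero_lt_two]

/-- The transference argument: at scale `r` the mollification is a bounded function to which the
dense theorem applies, and its form exceeds the error made in passing to any finer scale. -/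
theorem exists_pattern_of_isNearlyFull [Nontrivial V] {t : ℝ} (ht0 : t ≠ 0) (ht1 : t ≠ 1)
    (C : ℝ) {δ R : ℝ} (hδ : 0 < δ) (hR : 0 ≤ R) :
    ∃ ε₀ : ℝ, 0 < ε₀ ∧ ∀ (μ : Measure V) [IsFiniteMeasure μ] (α : ℝ),
      (finrank ℝ V : ℝ) - ε₀ < α → IsNearlyFull μ C α → δ ≤ μ.real Set.univ →
      (∀ x ∈ μ.support, ∀ y ∈ μ.support, dist x y ≤ R) →
        ∃ x y : V, y ≠ 0 ∧ x ∈ μ.support ∧ x + y ∈ μ.support ∧ x + t • y ∈ μ.support := by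
  have hK := mollifyConst_pos (V := V)
  -- The factor `2` is the allowance for `r ^ (-(n - α))`, so `M` is fixed before `r`; `|C| + 1`
  -- keeps it positive.
  set M : ℝ := mollifyConst V * (|C| + 1) * 2 with hM
  have hM0 : 0 < M := by positivity
  obtain ⟨κ, ρ, c, hκ, hκρ, hc, hpat⟩ := exists_lintegral_pattern_ge (V := V) t
    (R := R + 1) (by linarith) hδ hM0
  obtain ⟨W, hWc, hWs, hW0, hW1, hWκ, hW'⟩ := exists_annulus_weight V hκ hκρ
  set w : V → ℂ := fun y => (W y : ℂ) with hw
  have hwc : Continuous w := Complex.continuous_ofReal.comp hWc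
  have hws : HasCompactSupport w := hWs.comp_left (g := Complex.ofReal) Complex.ofReal_zero
  obtain ⟨ρ', hρ'⟩ := hWs.isCompact.isBounded.subset_closedBall (0 : V)
  obtain ⟨Q, -, hQ⟩ := exists_lintegral_cube_weight_le V C
  obtain ⟨r, hr0, hr2, hr⟩ := exists_small_scale (patternFormConst_ne_top t hW')
    (ENNReal.ofReal_pos.2 hc) Q
  have hl : 0 < log (1 / r) := log_pos (by rw [lt_div_iff₀ hr0]; linarith)
  refine ⟨log 2 / log (1 / r), div_pos (log_pos one_lt_two) hl, fun μ _ α hα hμ hmass hdiam => ?_⟩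
  have hμ0 : μ ≠ 0 := by
    rintro rfl
    simp at hmass
    linarith
  obtain ⟨x₀, hx₀⟩ := μ.nonempty_support hμ0
  have hcpt : IsCompact μ.support := by
    refine isCompact_of_isClosed_isBounded μ.isClosed_support ?_
    exact (isBounded_closedBall (x := x₀) (r := R)).subset fun x hx => hdiam x hx x₀ hx₀
  have hC := hμ.nonneg
  have hlow : ENNReal.ofReal c ≤ ‖patternForm t w (cmollify μ (halfBump hr0))
      (cmollify μ (halfBump hr0)) (cmollify μ (halfBump hr0))‖ₑ := by
    refine ofReal_le_enorm_patternForm hWc hWs hW0 hW1 ?_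
    refine hpat _ x₀ (continuous_mollify μ _).measurable (mollify_nonneg μ _) (fun x => ?_)
      (fun x hx => ?_) ?_
    · refine (hμ.mollify_le hr0 hr2 x).trans ?_
      rw [hM, abs_of_nonneg hC]
      have := rpow_neg_le_two hr0 (by linarith) (s := finrank ℝ V - α) (by linarith)
      gcongr
      linarith
    · by_contra hne
      obtain ⟨z, hz, hzx⟩ := exists_mem_support_of_mollify_ne_zero hne
      refine hx ?_
      have h1 : dist z x < r := hzx
      rw [mem_closedBall]
      have := dist_triangle_left x x₀ z
      linarith [hdiam z hz x₀ hx₀]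
    · rw [← ofReal_integral_eq_lintegral_ofReal (integrable_mollify μ _)
        (ae_of_all _ (mollify_nonneg μ _)), integral_mollify]
      exact ENNReal.ofReal_le_ofReal hmass
  obtain ⟨x, y, hy, hx, hxy, hxt⟩ := exists_pattern_of_approx hcpt (t := t) (κ := κ / 2) (ρ := ρ')
    fun s hs => by
      have hm0 : 0 < min r s := lt_min hr0 hs
      set φ : ContDiffBump (0 : V) := halfBump hm0 with hφ
      have hdiff := enorm_patternForm_cmollify_sub_le ht0 ht1 hwc hws hW' (hQ μ α hμ) (φ := φ)
        (ψ := halfBump hr0) (min_le_left r s)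
      -- Otherwise the error bound, which is below `c`, would dominate the form at scale `r`, which
      -- is at least `c`.
      have hne : patternForm t w (cmollify μ φ) (cmollify μ φ) (cmollify μ φ) ≠ 0 := by
        intro h0
        rw [h0, zero_sub, enorm_neg] at hdiff
        exact ((hlow.trans hdiff).trans_lt hr).false
      obtain ⟨p, hp⟩ : ∃ p : V × V, cmollify μ φ p.1 * cmollify μ φ (p.1 + p.2) *
          cmollify μ φ (p.1 + t • p.2) * w p.2 ≠ 0 := by
        by_contra! hall
        exact hne (integral_eq_zero_of_ae (ae_of_all _ hall))
      have hsupp : ∀ x, cmollify μ φ x ≠ 0 → ∃ z ∈ μ.support, dist z x < s := fun x hx => by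
        obtain ⟨z, hz, hzx⟩ := exists_mem_support_of_mollify_ne_zero
          (fun h => hx (by rw [cmollify, h, Complex.ofReal_zero]))
        exact ⟨z, hz, hzx.trans_le (min_le_right r s)⟩
      have hWp : W p.2 ≠ 0 := fun h => right_ne_zero_of_mul hp (by simp only [hw, h]; simp)
      have hp3 := left_ne_zero_of_mul hp
      have hp2 := left_ne_zero_of_mul hp3
      refine ⟨p.1, p.2, hWκ _ hWp, ?_, hsupp _ (left_ne_zero_of_mul hp2),
        hsupp _ (right_ne_zero_of_mul hp2), hsupp _ (right_ne_zero_of_mul hp3)⟩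
      simpa using hρ' (subset_tsupport _ hWp)
  refine ⟨x, y, ?_, hx, hxy, hxt⟩
  rintro rfl
  rw [norm_zero] at hy
  linarith

theorem measureFourier_eq_measFourier {n : ℕ} (μ : Measure (EuclideanSpace ℝ (Fin n)))
    (ξ : EuclideanSpace ℝ (Fin n)) : measureFourier μ ξ = measFourier μ ξ := by
  unfold measureFourier measFourier
  refine integral_congr_ae (ae_of_all _ fun x => ?_)
  simp only [Real.fourierChar_apply]
  congr 1
  push_cast
  ring

/-- For `n ≥ 1`, `β > 2n/3` gives `β / 2 > 1/3`; decay of order `1/3` suffices in every dimension.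
-/
theorem SatisfiesHypotheses.exists_isNearlyFull {n : ℕ} {C δ R ε₀ : ℝ}
    {E : Set (EuclideanSpace ℝ (Fin n))} (h : SatisfiesHypotheses n C δ R ε₀ E)
    (hn : 1 ≤ n) (hε₀ : ε₀ ≤ 1 / 12) :
    ∃ (μ : Measure (EuclideanSpace ℝ (Fin n))) (α : ℝ), IsFiniteMeasure μ ∧ μ.support ⊆ E ∧
      δ ≤ μ.real Set.univ ∧ (n : ℝ) - ε₀ < α ∧ IsNearlyFull μ C α := by
  obtain ⟨-, -, μ, hfin, hsupp, hmass, ⟨α, hα, hαn, hball⟩, β, hβ, -, hdec⟩ := h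
  refine ⟨μ, α, hfin, hsupp, hmass, hα, ⟨by simpa using hαn, by simp; linarith,
    fun z hz r hr0 hr1 => ?_, fun ξ => ?_⟩⟩
  · have := hball z (hsupp hz) r hr0 hr1
    rwa [div_le_iff₀ (by positivity)] at this
  · have h1 := hdec ξ
    rw [measureFourier_eq_measFourier] at h1
    have hx : 0 < 1 + ‖ξ‖ := by positivity
    have hn' : (1 : ℝ) ≤ n := by exact_mod_cast hn
    have h2 : (1 + ‖ξ‖) ^ (1 / 3 : ℝ) ≤ (1 + ‖ξ‖) ^ (β / 2) :=
      rpow_le_rpow_of_exponent_le (by linarith [norm_nonneg ξ]) (by linarith)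
    rw [rpow_neg hx.le, ← div_eq_mul_inv, le_div_iff₀ (by positivity)]
    exact (mul_le_mul_of_nonneg_left h2 (norm_nonneg _)).trans h1

theorem exists_pattern_of_satisfiesHypotheses (n : ℕ) {t : ℝ} (ht0 : t ≠ 0) (ht1 : t ≠ 1)
    (C δ R : ℝ) (hδ : 0 < δ) :
    ∃ ε₀ : ℝ, 0 < ε₀ ∧ ∀ E : Set (EuclideanSpace ℝ (Fin n)), SatisfiesHypotheses n C δ R ε₀ E →
      ∃ x y : EuclideanSpace ℝ (Fin n), y ≠ 0 ∧ x ∈ E ∧ x + y ∈ E ∧ x + t • y ∈ E := by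
  -- In dimension `0` the hypotheses are contradictory, as they ask for `0 < β < 0`.
  rcases Nat.eq_zero_or_pos n with rfl | hn
  · refine ⟨1, one_pos, fun E hE => ?_⟩
    obtain ⟨-, -, μ, -, -, -, -, β, hβ, hβ', -⟩ := hE
    norm_num at hβ hβ'
    linarith
  have : Nontrivial (EuclideanSpace ℝ (Fin n)) :=
    Module.nontrivial_of_finrank_pos (R := ℝ) (by simpa using hn)
  obtain ⟨ε, hε, H⟩ := exists_pattern_of_isNearlyFull (V := EuclideanSpace ℝ (Fin n)) ht0 ht1 C hδ
    (abs_nonneg R)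
  refine ⟨min ε (1 / 12), lt_min hε (by norm_num), fun E hE => ?_⟩
  obtain ⟨μ, α, hfin, hsupp, hmass, hα, hμ⟩ := hE.exists_isNearlyFull hn (min_le_right _ _)
  obtain ⟨x, y, hy, hx, hxy, hxt⟩ := H μ α
    (by rw [finrank_euclideanSpace_fin]; linarith [min_le_left ε (1 / 12)]) hμ hmass
    (fun x hx y hy => (hE.2.1 x (hsupp hx) y (hsupp hy)).trans (le_abs_self R))
  exact ⟨x, y, hy, hsupp hx, hsupp hxy, hsupp hxt⟩

theorem similar_of_pattern {a b c x y : V} {t : ℝ} (hab : a ≠ b) (hc : c = a + t • (b - a))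
    (hy : y ≠ 0) : Similar ![x, x + y, x + t • y] ![a, b, c] := by
  have hba : 0 < ‖b - a‖ := norm_pos_iff.2 (sub_ne_zero.2 hab.symm)
  rw [similar_iff_exists_pairwise_dist_eq]
  have hpos : 0 < ‖y‖ / ‖b - a‖ := div_pos (norm_pos_iff.2 hy) hba
  refine ⟨Real.toNNReal (‖y‖ / ‖b - a‖), (Real.toNNReal_pos.2 hpos).ne', ?_⟩
  rw [Real.coe_toNNReal _ hpos.le]
  have e01 : dist x (x + y) = ‖y‖ / ‖b - a‖ * dist a b := by
    rw [dist_self_add_right, dist_comm a, dist_eq_norm]; field_simp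
  have e02 : dist x (x + t • y) = ‖y‖ / ‖b - a‖ * dist a c := by
    rw [dist_self_add_right, hc, dist_self_add_right, norm_smul, norm_smul]; field_simp
  have e12 : dist (x + y) (x + t • y) = ‖y‖ / ‖b - a‖ * dist b c := by
    have h1 : y - t • y = (1 - t) • y := by module
    have h2 : b - (a + t • (b - a)) = (1 - t) • (b - a) := by module
    rw [dist_add_left, dist_eq_norm, dist_eq_norm, hc, h1, h2, norm_smul, norm_smul]; field_simp
  intro i j hij
  fin_cases i <;> fin_cases j <;> first
    | exact absurd rfl hij
    | exact e01
    | exact e02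
    | exact e12
    | exact (dist_comm _ _).trans (e01.trans (congrArg _ (dist_comm _ _)))
    | exact (dist_comm _ _).trans (e02.trans (congrArg _ (dist_comm _ _)))
    | exact (dist_comm _ _).trans (e12.trans (congrArg _ (dist_comm _ _)))

end SparsePatterns

end

theorem mainTheorem4 (n : ℕ) :
    (∀ a b c : EuclideanSpace ℝ (Fin n), a ≠ b → b ≠ c → a ≠ c → Collinear ℝ {a, b, c} →
      ∀ C δ R : ℝ, 0 < δ → ∃ ε₀ : ℝ, 0 < ε₀ ∧
        ∀ E : Set (EuclideanSpace ℝ (Fin n)), SatisfiesHypotheses n C δ R ε₀ E →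
          ∃ x ∈ E, ∃ y ∈ E, ∃ z ∈ E, x ≠ y ∧ y ≠ z ∧ x ≠ z ∧
            Similar ![x, y, z] ![a, b, c]) ∧
    (∀ C δ R : ℝ, 0 < δ → ∃ ε₀ : ℝ, 0 < ε₀ ∧
        ∀ E : Set (EuclideanSpace ℝ (Fin n)), SatisfiesHypotheses n C δ R ε₀ E →
          ∃ x y : EuclideanSpace ℝ (Fin n), y ≠ 0 ∧
            x ∈ E ∧ x + y ∈ E ∧ x + (2 : ℝ) • y ∈ E) := by
  refine ⟨fun a b c hab hbc hac hcol C δ R hδ => ?_, fun C δ R hδ =>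
    exists_pattern_of_satisfiesHypotheses n two_ne_zero (by norm_num) C δ R hδ⟩
  -- Affine coordinate of `c` on the line with `a` at `0` and `b` at `1`.
  obtain ⟨t, ht⟩ : ∃ t : ℝ, c = a + t • (b - a) := by
    obtain ⟨v, hv⟩ := (collinear_iff_of_mem (p₀ := a) (by simp)).1 hcol
    obtain ⟨s, hs⟩ := hv b (by simp)
    obtain ⟨u, hu⟩ := hv c (by simp)
    rw [vadd_eq_add] at hs hu
    have hs0 : s ≠ 0 := by
      rintro rfl
      exact hab (by rw [hs]; simp)
    refine ⟨u / s, ?_⟩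
    rw [hu, hs, add_sub_cancel_right, smul_smul, div_mul_cancel₀ _ hs0, add_comm]
  have ht0 : t ≠ 0 := by
    rintro rfl
    exact hac (by rw [ht]; simp)
  have ht1 : t ≠ 1 := by
    rintro rfl
    exact hbc (by rw [ht]; simp)
  obtain ⟨ε₀, hε₀, H⟩ := exists_pattern_of_satisfiesHypotheses n ht0 ht1 C δ R hδ
  refine ⟨ε₀, hε₀, fun E hE => ?_⟩
  obtain ⟨x, y, hy, hx, hxy, hxt⟩ := H E hE
  refine ⟨x, hx, x + y, hxy, x + t • y, hxt, ?_, ?_, ?_, similar_of_pattern hab ht hy⟩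
  · simpa using hy
  · intro h
    have h1 : (t - 1) • y = 0 := by
      rw [sub_smul, one_smul, sub_eq_zero]
      exact (add_left_cancel h).symm
    exact (smul_eq_zero.1 h1).elim (sub_ne_zero.2 ht1) hy
  · intro h
    exact (smul_eq_zero.1 (by simpa using h : t • y = 0)).elim ht0 hy
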